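/- **Setting.** There are $n\ge 0$ agents $A=\{1,\dots,n\}$, each with a private cost $c_i\ge 0$; there are a budget $B>0$ and a normalized ($v(\emptyset)=0$), non-negative, submodular, not necessarily monotone valuation $v:2^A\to\mathbb R_{\ge 0}$, accessed by value queries. Write $v(i\mid S)=v(S\cup\{i\})-v(S)$, and let $\mathrm{opt}(X,B)$ be the maximum of $v(S)$ over all $S\subseteq X$ with $\sum_{i\in S}c_i\le B$. The agents arrive one by one in some order and declare costs $b_i\ge 0$ upon arrival; agents declaring more than $B$ are rejected on arrival. *Dynkin's algorithm*: the first $\lfloor n/e\rfloor$ arrivals are only observed; afterwards, the first (not rejected) agent that beats all observed (not rejected) agents in value wins (ties in value are broken by a fixed order of the agents). *The offline subroutine* $\mathrm{ALG}_1$ is any, possibly randomized, algorithm for submodular maximization under a knapsack constraint: on an instance with ground set $X\subseteq A$ it returns a subset of $X$ of total cost at most the budget. **GenSm-Online** (with $\beta=8.725$). - With probability $2/5$, run Dynkin's algorithm and return the winner. - With probability $3/5$: let $S_1=S_2=T_1=T_2=\emptyset$ and $B_1=B_2=B$; choose the output $S$ to be $S_j$ with probability $1/10$ and $T_j$ with probability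 $2/5$, for each $j\in\{1,2\}$; draw $\xi$ from the binomial distribution $\mathcal B(n,\tfrac12)$. Reject all of the first $\xi$ agents, run $\mathrm{ALG}_1$ with budget $B$ on those of them that declared at most $B$, and let $x$ be the value of the solution found. When a later agent $i$ with $b_i\le B$ arrives, let $j\in\{1,2\}$ maximize $v(i\mid S_j)$ (ties in favour of $j=1$) and let $\pi=\frac{\beta B}{x}v(i\mid S_j)$. If $x>0$ and $b_i\le\pi\le B_j$, add $i$ to $S_j$, decrease $B_j$ by $\pi$, and with probability $1/2$ also add $i$ to $T_j$; otherwise reject $i$. Return $S$. The payments are the threshold payments: a winner $i$ receives the supremum of the declarations $t\ge b_i$ with which $i$ would still win, given the declarations of the others, the arrival order and the random bits; everybody else receives $0$. **Theorem.** 1. *(Online.)* For every fixed choice of the random bits, the allocation and the payment of each of the first $t$ agents depend only on the first $t$ arrivals, their declarations, and the values of sets of agents that have arrived by then. 2. *(Universal truthfulness, individual rationality, budget-feasibility.)* For every fixed choice of the random bits and every arrival order, the resulting deterministic mechanism is truthful (declaring the true cost is a dominant strategy), individually rational (payments are non-negative, and each winner is paid at least the declared cost) and budget-feasible (the total payment is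 at most $B$ for every vector of declarations). 3. *(Running time.)* There is a polynomial $P$ such that the allocation and the threshold payments are computed in at most $P(n)+q$ elementary steps, whenever $\mathrm{ALG}_1$ takes at most $q$ steps on every instance; value queries, arithmetic operations, comparisons, updates and random bits each take constant time. 4. *(Approximation in the secretary model.)* There are absolute constants $\delta,\eta>0$ such that, if on every instance $\mathrm{ALG}_1$ finds, with probability at least $1-\delta$, a solution of value at least $\left(\frac1e-\eta\right)$ times the optimum (in particular, if it is a deterministic $e$-approximation), then, for truthful declarations and a uniformly random arrival order, the set $X$ returned by GenSm-Online satisfies $$1710\cdot\mathbb E[v(X)]\ \ge\ \mathrm{opt}(A,B),$$ where the expectation is over the arrival order and all the random bits, including those of $\mathrm{ALG}_1$. -/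

import Mathlib

open scoped ENNReal

noncomputable section

namespace BudgetFeasible

/-! ### Valuations and the offline optimum -/

/-- Diminishing returns: `v(i | T) ≤ v(i | S)` whenever `S ⊆ T` and `i ∉ T`. -/
def IsSubmodular {α : Type} [DecidableEq α] (v : Finset α → ℝ) : Prop :=
  ∀ S T : Finset α, S ⊆ T → ∀ i, i ∉ T → v (insert i T) - v T ≤ v (insert i S) - v S

/-- Normalized, non-negative, submodular (not necessarily monotone) set functions. -/
structure IsValuation {α : Type} [DecidableEq α] (v : Finset α → ℝ) : Prop where
  empty : v ∅ = 0
  nonneg : ∀ S, 0 ≤ v S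
  submodular : IsSubmodular v

/-- The value of an optimal subset of total cost at most `B`. -/
def opt {α : Type} (v : Finset α → ℝ) (c : α → ℝ) (B : ℝ) : ℝ :=
  sSup {y | ∃ S : Finset α, ∑ i ∈ S, c i ≤ B ∧ v S = y}

/-! ### Deterministic mechanisms for procurement with private costs -/

/-- An outcome rule and a payment rule, both functions of the declared costs. -/
structure Mechanism (n : ℕ) where
  outcome : (Fin n → ℝ) → Finset (Fin n)
  payment : (Fin n → ℝ) → Fin n → ℝ

namespace Mechanism

variable {n : ℕ}

/-- Utility of agent `i` with true cost `ci` under the declarations `b`: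
the payment, minus the cost if the agent is selected. -/
def utility (M : Mechanism n) (b : Fin n → ℝ) (i : Fin n) (ci : ℝ) : ℝ :=
  M.payment b i - if i ∈ M.outcome b then ci else 0

/-- Declaring the true cost is a dominant strategy for every agent. -/
def Truthful (M : Mechanism n) : Prop :=
  ∀ b : Fin n → ℝ, (∀ j, 0 ≤ b j) → ∀ (i : Fin n) (ci bi : ℝ), 0 ≤ ci → 0 ≤ bi →
    M.utility (Function.update b i bi) i ci ≤ M.utility (Function.update b i ci) i ci

/-- Payments are non-negative, and cover the declared costs of the winners. -/
def IndividuallyRational (M : Mechanism n) : Prop :=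
  ∀ b : Fin n → ℝ, (∀ j, 0 ≤ b j) →
    (∀ i, 0 ≤ M.payment b i) ∧ ∀ i ∈ M.outcome b, b i ≤ M.payment b i

/-- The total payment never exceeds the budget. -/
def IsBudgetFeasible (M : Mechanism n) (B : ℝ) : Prop :=
  ∀ b : Fin n → ℝ, (∀ j, 0 ≤ b j) → ∑ i, M.payment b i ≤ B

end Mechanism

/-- Threshold payments: a winner receives the supremum of the declarations, at least as high as
the present one, with which the agent still wins; all others receive nothing. -/
def thresholdPayment {n : ℕ} (f : (Fin n → ℝ) → Finset (Fin n)) (b : Fin n → ℝ) (i : Fin n) : ℝ :=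
  if i ∈ f b then sSup {t | b i ≤ t ∧ i ∈ f (Function.update b i t)} else 0

/-- A family of mechanisms, indexed by the valuation and by the arrival order (`σ k` is the agent
arriving in position `k`), is online if the allocation and the payment of each of the first `t`
agents are determined by the first `t` arrivals, their declarations, and the values of the sets of
agents that have arrived. -/
def IsOnline {n : ℕ} (F : (Finset (Fin n) → ℝ) → Equiv.Perm (Fin n) → Mechanism n) : Prop :=
  ∀ (t : ℕ) (v v' : Finset (Fin n) → ℝ) (σ σ' : Equiv.Perm (Fin n)) (b b' : Fin n → ℝ),
    (∀ k : Fin n, (k : ℕ) < t → σ k = σ' k ∧ b (σ k) = b' (σ k)) →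
    (∀ S : Finset (Fin n), (∀ i ∈ S, ∃ k : Fin n, (k : ℕ) < t ∧ σ k = i) → v S = v' S) →
    ∀ k : Fin n, (k : ℕ) < t →
      (σ k ∈ (F v σ).outcome b ↔ σ k ∈ (F v' σ').outcome b') ∧
      (F v σ).payment b (σ k) = (F v' σ').payment b' (σ k)

/-! ### Step counting in the value query model -/

/-- The result of a computation together with the number of elementary steps it takes. -/
structure Timed (α : Type) where
  val : α
  steps : ℕ

instance : Monad Timed where
  pure a := ⟨a, 0⟩
  bind x f := ⟨(f x.val).val, x.steps + (f x.val).steps⟩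

/-- Spend `k` elementary steps (arithmetic operations, comparisons, updates, random bits). -/
def tick (k : ℕ) : Timed Unit := ⟨(), k⟩

/-- A value query, at unit cost. -/
def query {α : Type} (v : Finset α → ℝ) (S : Finset α) : Timed ℝ := ⟨v S, 1⟩

/-! ### The offline subroutine -/

/-- A randomized algorithm, with random seeds in `Ω`, for maximizing a set function under a
knapsack constraint. An instance has a set `X ⊆ {0, …, n - 1}` as its ground set, and
consists of a valuation of the subsets of `X`, costs of the elements of `X`, and a budget. -/
abbrev KnapsackAlg (n : ℕ) (Ω : Type) : Type :=
  (X : Finset (Fin n)) → (Finset X → ℝ) → (X → ℝ) → ℝ → Ω → Timed (Finset X)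

/-- On every instance the algorithm returns a solution within the budget, and with probability at
least `1 - δ` the value of this solution is at least `a` times the optimum. -/
def KnapsackAlg.IsApprox {n : ℕ} {Ω : Type} [Fintype Ω] (alg : KnapsackAlg n Ω) (law : PMF Ω)
    (a δ : ℝ) : Prop :=
  ∀ (X : Finset (Fin n)) (v : Finset X → ℝ) (c : X → ℝ) (B : ℝ),
    IsValuation v → (∀ i, 0 ≤ c i) → 0 < B →
    (∀ ω ∈ law.support, ∑ i ∈ (alg X v c B ω).val, c i ≤ B) ∧
    1 - δ ≤ (law.toOuterMeasure {ω | a * opt v c B ≤ v (alg X v c B ω).val}).toReal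

/-- On every instance the algorithm takes at most `q` steps. -/
def KnapsackAlg.RunsIn {n : ℕ} {Ω : Type} (alg : KnapsackAlg n Ω) (q : ℕ) : Prop :=
  ∀ (X : Finset (Fin n)) (v : Finset X → ℝ) (c : X → ℝ) (B : ℝ) (ω : Ω),
    IsValuation v → (∀ i, 0 ≤ c i) → 0 < B → (alg X v c B ω).steps ≤ q

/-! ### The random bits -/

/-- The random bits of the mechanism. The number of `true` entries of `split` is binomially
distributed with parameters `n` and `1/2` under `seedLaw`. -/
structure Seed (n : ℕ) (Ω : Type) where
  /-- run Dynkin's algorithm -/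
  dynkin : Bool
  /-- output one of `T₁, T₂` (`true`) or one of `S₁, S₂` (`false`) -/
  useT : Bool
  /-- the index of the set that is output -/
  side : Fin 2
  /-- `n` fair coins; the number of heads is the length of the sample -/
  split : Fin n → Bool
  /-- one fair coin for each agent, deciding on its membership in `T₁` or `T₂` -/
  coin : Fin n → Bool
  /-- the seed of the offline subroutine -/
  sub : Ω

instance {n : ℕ} {Ω : Type} [Fintype Ω] : Fintype (Seed n Ω) :=
  Fintype.ofEquiv (Bool × Bool × Fin 2 × (Fin n → Bool) × (Fin n → Bool) × Ω)
    { toFun := fun p => ⟨p.1, p.2.1, p.2.2.1, p.2.2.2.1, p.2.2.2.2.1, p.2.2.2.2.2⟩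
      invFun := fun ρ => (ρ.dynkin, ρ.useT, ρ.side, ρ.split, ρ.coin, ρ.sub)
      left_inv := fun _ => rfl
      right_inv := fun _ => rfl }

/-- `true` with probability `2/5`. -/
def modeLaw : PMF Bool :=
  PMF.ofFintype (fun d => if d then ENNReal.ofReal (2 / 5) else ENNReal.ofReal (3 / 5)) (by
    simp only [Fintype.sum_bool, if_true, Bool.false_eq_true, if_false]
    rw [← ENNReal.ofReal_add (by norm_num) (by norm_num)]
    norm_num)

/-- Each `T_j` has probability `2/5` and each `S_j` has probability `1/10`. -/
def pickLaw : PMF (Bool × Fin 2) :=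
  PMF.ofFintype (fun p => if p.1 then ENNReal.ofReal (2 / 5) else ENNReal.ofReal (1 / 10)) (by
    simp only [Fintype.sum_prod_type, Fintype.sum_bool, Fin.sum_univ_two, if_true,
      Bool.false_eq_true, if_false]
    rw [← ENNReal.ofReal_add (by norm_num) (by norm_num),
      ← ENNReal.ofReal_add (by norm_num) (by norm_num),
      ← ENNReal.ofReal_add (by norm_num) (by norm_num)]
    norm_num)

/-- The joint law of the random bits; all components are independent. -/
def seedLaw (n : ℕ) {Ω : Type} (law : PMF Ω) : PMF (Seed n Ω) := do
  let d ← modeLaw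
  let p ← pickLaw
  let s ← PMF.uniformOfFintype (Fin n → Bool)
  let u ← PMF.uniformOfFintype (Fin n → Bool)
  let ω ← law
  pure ⟨d, p.1, p.2, s, u, ω⟩

/-- Expectation under a probability law on a finite type. -/
def expect {α : Type} [Fintype α] (p : PMF α) (f : α → ℝ) : ℝ := ∑ a, (p a).toReal * f a

/-! ### The mechanism -/

section Algorithm

open Classical

variable {n : ℕ} {Ω : Type}

/-- The agents in their order of arrival. -/
def arrivals (σ : Equiv.Perm (Fin n)) : List (Fin n) := (List.finRange n).map σ

/-- Comparison of two agents by their values, where ties are broken by the labels. -/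
def Better (v : Finset (Fin n) → ℝ) (i j : Fin n) : Prop :=
  v {j} < v {i} ∨ (v {j} = v {i} ∧ i < j)

/-- The test `Better v i j`, where `none` is beaten by every agent. -/
def beats (v : Finset (Fin n) → ℝ) (i : Fin n) : Option (Fin n) → Timed Bool
  | none => do
      tick 1
      pure true
  | some j => do
      let _ ← query v {i}
      let _ ← query v {j}
      tick 3
      pure (decide (Better v i j))

/-- One arrival in the sampling phase of Dynkin's algorithm. The state is the best agent so far;
agents declaring more than the budget are ignored. -/
def dynkinSample (v : Finset (Fin n) → ℝ) (b : Fin n → ℝ) (B : ℝ) (best : Option (Fin n))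
    (i : Fin n) : Timed (Option (Fin n)) := do
  tick 1
  if B < b i then pure best
  else
    let better ← beats v i best
    tick 1
    if better then pure (some i) else pure best

/-- One arrival in the selection phase of Dynkin's algorithm. The state is the winner, if there is
one already; `best` is the best agent of the sample. -/
def dynkinSelect (v : Finset (Fin n) → ℝ) (b : Fin n → ℝ) (B : ℝ) (best : Option (Fin n))
    (winner : Option (Fin n)) (i : Fin n) : Timed (Option (Fin n)) := do
  tick 2
  if winner.isSome ∨ B < b i then pure winner
  else
    let better ← beats v i best
    tick 1
    if better then pure (some i) else pure winner

/-- Dynkin's algorithm: the first `⌊n / e⌋` agents are only observed; afterwards the first agent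
that beats all observed ones wins, and is paid the budget. -/
def dynkin (v : Finset (Fin n) → ℝ) (b : Fin n → ℝ) (B : ℝ) (σ : Equiv.Perm (Fin n)) :
    Timed (Finset (Fin n) × (Fin n → ℝ)) := do
  let r := ⌊(n : ℝ) / Real.exp 1⌋₊
  tick 2
  let best ← ((arrivals σ).take r).foldlM (dynkinSample v b B) none
  let winner ← ((arrivals σ).drop r).foldlM (dynkinSelect v b B best) none
  tick n
  pure (winner.toFinset, fun i => if winner = some i then B else 0)

/-- The state of the threshold phase: the sets `S_j` and `T_j`, the remaining budgets `B_j`, and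
the prices at which agents were accepted. -/
structure State (n : ℕ) where
  S : Fin 2 → Finset (Fin n)
  T : Fin 2 → Finset (Fin n)
  budget : Fin 2 → ℝ
  price : Fin n → ℝ

/-- The marginal value `v(i | S)`. -/
def marginal (v : Finset (Fin n) → ℝ) (i : Fin n) (S : Finset (Fin n)) : Timed ℝ := do
  let y ← query v (insert i S)
  let z ← query v S
  tick 2
  pure (y - z)

/-- The parameter of the mechanism. -/
def β : ℝ := 8.725

/-- One arrival in the threshold phase with estimate `x`. Nobody is accepted if `x ≤ 0`. -/
def thresholdStep (v : Finset (Fin n) → ℝ) (b : Fin n → ℝ) (B x : ℝ) (coin : Fin n → Bool)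
    (s : State n) (i : Fin n) : Timed (State n) := do
  tick 1
  if B < b i then pure s
  else
    let m₀ ← marginal v i (s.S 0)
    let m₁ ← marginal v i (s.S 1)
    let j : Fin 2 := if m₁ ≤ m₀ then 0 else 1
    let price := β * B / x * max m₀ m₁
    tick 8
    if 0 < x ∧ b i ≤ price ∧ price ≤ s.budget j then
      tick 6
      pure { S := Function.update s.S j (insert i (s.S j))
             T := if coin i then Function.update s.T j (insert i (s.T j)) else s.T
             budget := Function.update s.budget j (s.budget j - price)
             price := Function.update s.price i price }
    else pure s

/-- The online mechanism: the selected set and the payments, for the valuation `v`, the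
declarations `b`, the budget `B`, the arrival order `σ` and the random bits `ρ`. -/
def genSmOnline (alg : KnapsackAlg n Ω) (v : Finset (Fin n) → ℝ) (b : Fin n → ℝ) (B : ℝ)
    (σ : Equiv.Perm (Fin n)) (ρ : Seed n Ω) : Timed (Finset (Fin n) × (Fin n → ℝ)) := do
  tick 1
  if ρ.dynkin then dynkin v b B σ
  else
    tick (2 * n + 5)
    let ξ := (Finset.univ.filter fun i => ρ.split i = true).card
    let X := ((arrivals σ).take ξ).toFinset.filter fun i => b i ≤ B
    tick n
    let R ← alg X (fun S => v (S.map (Function.Embedding.subtype _))) (fun i => b i) B ρ.sub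
    let x ← query v (R.map (Function.Embedding.subtype _))
    let s ← ((arrivals σ).drop ξ).foldlM (thresholdStep v b B x ρ.coin)
      ⟨fun _ => ∅, fun _ => ∅, fun _ => B, fun _ => 0⟩
    let out := if ρ.useT then s.T ρ.side else s.S ρ.side
    tick (2 * n)
    pure (out, fun i => if i ∈ out then s.price i else 0)

/-- The deterministic mechanism obtained by fixing the arrival order and the random bits, with
threshold payments. -/
def genSmMechanism (alg : KnapsackAlg n Ω) (B : ℝ) (ρ : Seed n Ω)
    (v : Finset (Fin n) → ℝ) (σ : Equiv.Perm (Fin n)) : Mechanism n where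
  outcome b := (genSmOnline alg v b B σ ρ).val.1
  payment b := thresholdPayment (fun b' => (genSmOnline alg v b' B σ ρ).val.1) b

end Algorithm

end BudgetFeasible

end

/-! The incentive properties rest on one observation. Once the order and the random bits are fixed,
whether an agent receives an offer, and at which price, is computed from the earlier arrivals and
from values of sets of arrived agents; her own declaration enters only through a final comparison
with that price (`IsPosted`). A take-it-or-leave-it offer makes truth-telling dominant and
individually rational, and its price is the threshold payment. Since everything else depends on the
history alone, the mechanism is online. Budget-feasibility is bookkeeping: accepted prices are
deducted from a budget that never becomes negative, and Dynkin's winner is paid `B`.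

For the approximation, let `W` be the optimum, `O` an optimal set and `M` the largest value of a
single affordable agent. The marginal values along an ordering of `O` are weights `w` with `0 ≤ w i
≤ M`, total `W`, and `w(D) ≤ v (O ∩ D)` (`IsValuation.exists_opt_weights`). A prefix of binomial
length of a random permutation is a uniformly random set (`sum_prefix`), so its weight has mean `W /
2` and variance at most `M * W / 4`. Except with probability at most `100 * M / (9 * W)` the sample
and the rest both have weight at least `0.35 * W`, and then a successful subroutine yields `0.126 *
W ≤ x ≤ W`.

Let `Q` be the part of `O` outside the sample (`State.value_run`). If a budget blocks an agent of
`Q`, some `S_j` has value at least `x / β - M`. Otherwise an agent of `Q` was either rejected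
because her cost exceeds the price, so her marginal values are small relative to her cost, or she
joined one of the two sets, and then her marginal value for the other set is at most what she
contributed. Hence `v (S_j ∪ Q) ≤ v (S 0) + v (S 1) + x / β` for both `j`. The two sets are
disjoint, so submodularity and non-negativity give `v Q ≤ v (S 0 ∪ Q) + v (S 1 ∪ Q)`; this replaces
monotonicity. In both cases `v (S 0) + v (S 1) ≥ 0.01444 * W - M`. Dynkin's algorithm earns at least
`0.126 * M` in expectation, and mixing the two branches beats `W / 1710` for every ratio `M / W`.
The sets `T_j` contribute only non-negativity to this bound. -/

noncomputable section

namespace BudgetFeasible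

/-! ### Timed computations -/

@[simp] theorem Timed.val_pure {α : Type} (a : α) : (pure a : Timed α).val = a := rfl

@[simp] theorem Timed.steps_pure {α : Type} (a : α) : (pure a : Timed α).steps = 0 := rfl

@[simp] theorem Timed.val_bind {α γ : Type} (x : Timed α) (f : α → Timed γ) :
    (x >>= f).val = (f x.val).val := rfl

@[simp] theorem Timed.steps_bind {α γ : Type} (x : Timed α) (f : α → Timed γ) :
    (x >>= f).steps = x.steps + (f x.val).steps := rfl

@[simp] theorem tick_steps (k : ℕ) : (tick k).steps = k := rfl

@[simp] theorem query_val {α : Type} (v : Finset α → ℝ) (S : Finset α) :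
    (query v S).val = v S := rfl

@[simp] theorem query_steps {α : Type} (v : Finset α → ℝ) (S : Finset α) :
    (query v S).steps = 1 := rfl

theorem Timed.val_foldlM {α γ : Type} (f : γ → α → Timed γ) (s : γ) (l : List α) :
    (l.foldlM f s).val = l.foldl (fun s a => (f s a).val) s := by
  induction l generalizing s with
  | nil => rfl
  | cons a l ih => simp [List.foldlM_cons, ih]

theorem Timed.steps_foldlM_le {α γ : Type} (f : γ → α → Timed γ) (k : ℕ)
    (h : ∀ s a, (f s a).steps ≤ k) (s : γ) (l : List α) :
    (l.foldlM f s).steps ≤ k * l.length := by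
  induction l generalizing s with
  | nil => simp
  | cons a l ih =>
    simp only [List.foldlM_cons, Timed.steps_bind, List.length_cons]
    have h1 := h s a
    have h2 := ih (f s a).val
    rw [Nat.mul_add]
    omega

/-- If two step functions agree along a list, as long as an invariant of the states holds, then so
do the folds. -/
theorem foldl_congr_of_invariant {α γ : Type} (f g : γ → α → γ) (I : γ → Prop) (l : List α)
    (h : ∀ a ∈ l, ∀ s, I s → f s a = g s a ∧ I (f s a)) (s : γ) (hs : I s) :
    l.foldl f s = l.foldl g s ∧ I (l.foldl f s) := by
  induction l generalizing s with
  | nil => exact ⟨rfl, hs⟩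
  | cons a l ih =>
    obtain ⟨h1, h2⟩ := h a (by simp) s hs
    simp only [List.foldl_cons, ← h1]
    exact ih (fun a ha => h a (by simp [ha])) _ h2

/-- Invariants of folds. -/
theorem foldl_invariant {α γ : Type} (f : γ → α → γ) (I : γ → Prop) (l : List α)
    (h : ∀ a ∈ l, ∀ s, I s → I (f s a)) (s : γ) (hs : I s) : I (l.foldl f s) :=
  (foldl_congr_of_invariant f f I l (fun a ha s hs => ⟨rfl, h a ha s hs⟩) s hs).2

section Algorithm

open Classical

variable {n : ℕ} {Ω : Type}

/-! ### Arrival sequences -/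

theorem mem_arrivals (σ : Equiv.Perm (Fin n)) (i : Fin n) : i ∈ arrivals σ := by
  simp only [arrivals, List.mem_map, List.mem_finRange, true_and]
  exact ⟨σ.symm i, by simp⟩

theorem nodup_arrivals (σ : Equiv.Perm (Fin n)) : (arrivals σ).Nodup :=
  (List.nodup_finRange n).map σ.injective

@[simp] theorem length_arrivals (σ : Equiv.Perm (Fin n)) : (arrivals σ).length = n := by
  simp [arrivals]

theorem getElem_arrivals (σ : Equiv.Perm (Fin n)) (k : ℕ) (hk : k < (arrivals σ).length) :
    (arrivals σ)[k] = σ ⟨k, by simpa using hk⟩ := by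
  simp [arrivals]

theorem mem_take_arrivals (σ : Equiv.Perm (Fin n)) (r : ℕ) (k : Fin n) :
    σ k ∈ (arrivals σ).take r ↔ (k : ℕ) < r := by
  rw [List.mem_take_iff_getElem]
  constructor
  · rintro ⟨j, hj, h⟩
    rw [getElem_arrivals] at h
    have := σ.injective h
    subst this
    simp only [length_arrivals] at hj
    simp only
    omega
  · intro h
    exact ⟨k, by simp [h], by rw [getElem_arrivals]⟩

/-- Isolates agent `σ k` among the arrivals after the sample. A fold over them then becomes a state
depending on earlier agents, one decision about `σ k`, and a tail that cannot affect her. -/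
theorem drop_arrivals_eq (σ : Equiv.Perm (Fin n)) (r : ℕ) (k : Fin n) (h : r ≤ k) :
    (arrivals σ).drop r =
      ((arrivals σ).take k).drop r ++ σ k :: (arrivals σ).drop (k + 1) := by
  have hk : (k : ℕ) < (arrivals σ).length := by simp
  have h1 : σ k = (arrivals σ)[(k : ℕ)] := by rw [getElem_arrivals]
  rw [h1, List.getElem_cons_drop]
  conv_lhs => rw [← List.take_append_drop k (arrivals σ)]
  rw [List.drop_append_of_le_length]
  simp; omega

theorem notMem_take_arrivals (σ : Equiv.Perm (Fin n)) (k : Fin n) :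
    σ k ∉ (arrivals σ).take k := by
  simp [mem_take_arrivals]

theorem notMem_drop_arrivals (σ : Equiv.Perm (Fin n)) (k : Fin n) :
    σ k ∉ (arrivals σ).drop (k + 1) := by
  have h := nodup_arrivals σ
  rw [← List.take_append_drop (k + 1) (arrivals σ)] at h
  intro h2
  exact (List.disjoint_of_nodup_append h) ((mem_take_arrivals σ _ k).2 (by omega)) h2

theorem mem_drop_arrivals (σ : Equiv.Perm (Fin n)) (r : ℕ) (k : Fin n) :
    σ k ∈ (arrivals σ).drop r ↔ r ≤ (k : ℕ) := by
  constructor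
  · intro h
    by_contra h2
    have hn := nodup_arrivals σ
    rw [← List.take_append_drop r (arrivals σ)] at hn
    exact (List.disjoint_of_nodup_append hn) ((mem_take_arrivals σ _ k).2 (by omega)) h
  · intro h
    rw [drop_arrivals_eq σ r k h]
    simp

theorem take_arrivals_congr {t : ℕ} {σ σ' : Equiv.Perm (Fin n)}
    (h : ∀ k : Fin n, (k : ℕ) < t → σ k = σ' k) {r : ℕ} (hr : r ≤ t) :
    (arrivals σ).take r = (arrivals σ').take r := by
  apply List.ext_getElem
  · simp
  · intro k h1 h2
    simp only [List.length_take, length_arrivals] at h1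
    rw [List.getElem_take, List.getElem_take, getElem_arrivals, getElem_arrivals]
    exact h _ (by simp only; omega)

/-! ### Posted prices -/

/-- Agent `i` faces a take-it-or-leave-it offer that does not depend on her own declaration. -/
def IsPosted (f : (Fin n → ℝ) → Finset (Fin n)) (b : Fin n → ℝ) (i : Fin n) (p : ℝ)
    (Q : Prop) : Prop :=
  ∀ t, i ∈ f (Function.update b i t) ↔ Q ∧ t ≤ p

/-- For a winner declaring `t`, the winning declarations from `t` upwards form the interval `[t,
p]`, whose supremum is `p`. -/
theorem IsPosted.thresholdPayment_eq {f : (Fin n → ℝ) → Finset (Fin n)} {b : Fin n → ℝ}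
    {i : Fin n} {p : ℝ} {Q : Prop} (h : IsPosted f b i p Q) (t : ℝ) :
    thresholdPayment f (Function.update b i t) i = if Q ∧ t ≤ p then p else 0 := by
  unfold thresholdPayment
  by_cases hw : Q ∧ t ≤ p
  · rw [if_pos ((h t).2 hw), if_pos hw]
    have : {u | Function.update b i t i ≤ u ∧
        i ∈ f (Function.update (Function.update b i t) i u)} = Set.Icc t p := by
      ext u
      simp only [Function.update_self, Function.update_idem, Set.mem_ofPred_eq, Set.mem_Icc]
      rw [h u]
      tauto
    rw [this, csSup_Icc hw.2]
  · rw [if_neg (fun h2 => hw ((h t).1 h2)), if_neg hw]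

/-- The mechanism with outcome rule `f` and threshold payments. -/
def thresholdMechanism (f : (Fin n → ℝ) → Finset (Fin n)) : Mechanism n where
  outcome := f
  payment := thresholdPayment f

/-- The declaration decides only whether the offer `p` is accepted; the true cost accepts it exactly
when `p - ci` is non-negative. -/
theorem truthful_of_posted {f : (Fin n → ℝ) → Finset (Fin n)}
    (h : ∀ b : Fin n → ℝ, ∀ i, ∃ p Q, IsPosted f b i p Q) :
    (thresholdMechanism f).Truthful := by
  intro b _ i ci bi _ _
  obtain ⟨p, Q, hp⟩ := h b i
  simp only [Mechanism.utility, thresholdMechanism, hp.thresholdPayment_eq, hp _]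
  by_cases hQ : Q <;> simp only [hQ, true_and, false_and, if_false, le_refl]
  by_cases h1 : bi ≤ p <;> by_cases h2 : ci ≤ p <;> simp [h1, h2] <;> linarith

theorem individuallyRational_of_posted {f : (Fin n → ℝ) → Finset (Fin n)}
    (h : ∀ b : Fin n → ℝ, ∀ i, ∃ p Q, IsPosted f b i p Q) :
    (thresholdMechanism f).IndividuallyRational := by
  intro b hb
  have key : ∀ i, (i ∈ f b → b i ≤ thresholdPayment f b i) ∧ 0 ≤ thresholdPayment f b i := by
    intro i
    obtain ⟨p, Q, hp⟩ := h b i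
    have h1 := hp.thresholdPayment_eq (b i)
    have h2 := hp (b i)
    rw [Function.update_eq_self] at h1 h2
    rw [h1, h2]
    by_cases hw : Q ∧ b i ≤ p
    · simp only [if_pos hw]
      exact ⟨fun _ => hw.2, (hb i).trans hw.2⟩
    · simp only [if_neg hw]
      exact ⟨fun h => absurd h hw, le_rfl⟩
  exact ⟨fun i => (key i).2, fun i hi => (key i).1 hi⟩

/-! ### Dynkin's algorithm -/

/-- The best affordable agent of a sample. -/
def sampleBest (v : Finset (Fin n) → ℝ) (b : Fin n → ℝ) (B : ℝ) (l : List (Fin n)) :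
    Option (Fin n) :=
  l.foldl (fun s i => (dynkinSample v b B s i).val) none

/-- The winner among later arrivals. -/
def selectFirst (v : Finset (Fin n) → ℝ) (b : Fin n → ℝ) (B : ℝ) (best : Option (Fin n))
    (l : List (Fin n)) : Option (Fin n) :=
  l.foldl (fun s i => (dynkinSelect v b B best s i).val) none

/-- The length of the sample of Dynkin's algorithm. -/
def sampleSize (n : ℕ) : ℕ := ⌊(n : ℝ) / Real.exp 1⌋₊

/-- The winner of Dynkin's algorithm. -/
def dynkinWinner (v : Finset (Fin n) → ℝ) (b : Fin n → ℝ) (B : ℝ) (σ : Equiv.Perm (Fin n)) :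
    Option (Fin n) :=
  selectFirst v b B (sampleBest v b B ((arrivals σ).take (sampleSize n)))
    ((arrivals σ).drop (sampleSize n))

theorem dynkin_val (v : Finset (Fin n) → ℝ) (b : Fin n → ℝ) (B : ℝ) (σ : Equiv.Perm (Fin n)) :
    (dynkin v b B σ).val =
      ((dynkinWinner v b B σ).toFinset, fun i => if dynkinWinner v b B σ = some i then B else 0) := by
  simp only [dynkin, Timed.val_bind, Timed.val_pure, Timed.val_foldlM]
  rfl

/-- Agent `i` beats the best agent of the sample, if there is one. -/
def BeatsBest (v : Finset (Fin n) → ℝ) (i : Fin n) (best : Option (Fin n)) : Prop :=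
  ∀ j ∈ best, Better v i j

theorem beats_val (v : Finset (Fin n) → ℝ) (i : Fin n) (best : Option (Fin n)) :
    (beats v i best).val = decide (BeatsBest v i best) := by
  cases best <;> simp [beats, BeatsBest]

theorem dynkinSample_val (v : Finset (Fin n) → ℝ) (b : Fin n → ℝ) (B : ℝ)
    (best : Option (Fin n)) (i : Fin n) :
    (dynkinSample v b B best i).val =
      if b i ≤ B ∧ BeatsBest v i best then some i else best := by
  simp only [dynkinSample, Timed.val_bind]
  split_ifs with h1 h2 h2 <;> simp_all [beats_val] <;> linarith

theorem dynkinSelect_val (v : Finset (Fin n) → ℝ) (b : Fin n → ℝ) (B : ℝ)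
    (best winner : Option (Fin n)) (i : Fin n) :
    (dynkinSelect v b B best winner i).val =
      if winner = none ∧ b i ≤ B ∧ BeatsBest v i best then some i else winner := by
  simp only [dynkinSelect, Timed.val_bind]
  rcases winner with _ | w
  · by_cases h1 : b i ≤ B <;> by_cases h2 : BeatsBest v i best <;>
      simp [beats_val, ← not_le, h1, h2]
  · simp

theorem foldl_select_some (v : Finset (Fin n) → ℝ) (b : Fin n → ℝ) (B : ℝ)
    (best : Option (Fin n)) (w : Fin n) (l : List (Fin n)) :
    l.foldl (fun s i => (dynkinSelect v b B best s i).val) (some w) = some w := by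
  induction l with
  | nil => rfl
  | cons a l ih =>
    rw [List.foldl_cons, dynkinSelect_val, if_neg (by simp)]
    exact ih

theorem foldl_select_mem (v : Finset (Fin n) → ℝ) (b : Fin n → ℝ) (B : ℝ)
    (best : Option (Fin n)) (w : Fin n) (l : List (Fin n)) (hw : selectFirst v b B best l = some w) :
    w ∈ l ∧ b w ≤ B ∧ BeatsBest v w best := by
  have := foldl_invariant (fun s i => (dynkinSelect v b B best s i).val)
    (fun s => ∀ w, s = some w → w ∈ l ∧ b w ≤ B ∧ BeatsBest v w best) l (by
      intro a ha s hs
      rw [dynkinSelect_val]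
      split_ifs with h
      · rintro w ⟨⟩
        exact ⟨ha, h.2⟩
      · exact hs) none (by simp)
  exact this w hw

/-- Once set, the winner never changes, and agents of `l₂` can only make themselves win. So the fate
of `i` is settled at her own arrival. -/
theorem selectFirst_append (v : Finset (Fin n) → ℝ) (b : Fin n → ℝ) (B : ℝ)
    (best : Option (Fin n)) (i : Fin n) (l₁ l₂ : List (Fin n)) (h₁ : i ∉ l₁) (h₂ : i ∉ l₂) :
    selectFirst v b B best (l₁ ++ i :: l₂) = some i ↔
      (selectFirst v b B best l₁ = none ∧ BeatsBest v i best) ∧ b i ≤ B := by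
  conv_lhs => rw [selectFirst, List.foldl_append, List.foldl_cons]
  rw [← selectFirst]
  rcases h : selectFirst v b B best l₁ with _ | w
  · rw [dynkinSelect_val]
    split_ifs with hc
    · rw [foldl_select_some]
      simp [hc]
    · constructor
      · intro hh
        exact absurd (foldl_select_mem v b B best i l₂ hh).1 h₂
      · tauto
  · rw [dynkinSelect_val, if_neg (by simp), foldl_select_some]
    have := (foldl_select_mem v b B best w l₁ h).1
    simp only [Option.some.injEq, reduceCtorEq, false_and, iff_false]
    rintro rfl
    exact h₁ this

/-- The right-hand side is grouped as a condition on the history and on values, followed by `b (σ k)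
≤ B`: the shape of an offer at price `B`. -/
theorem dynkinWinner_eq_some (v : Finset (Fin n) → ℝ) (b : Fin n → ℝ) (B : ℝ)
    (σ : Equiv.Perm (Fin n)) (k : Fin n) :
    dynkinWinner v b B σ = some (σ k) ↔
      (sampleSize n ≤ k ∧
        selectFirst v b B (sampleBest v b B ((arrivals σ).take (sampleSize n)))
          (((arrivals σ).take k).drop (sampleSize n)) = none ∧
        BeatsBest v (σ k) (sampleBest v b B ((arrivals σ).take (sampleSize n)))) ∧
      b (σ k) ≤ B := by
  by_cases hk : sampleSize n ≤ k
  · rw [dynkinWinner, drop_arrivals_eq σ _ k hk,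
      selectFirst_append _ _ _ _ _ _ _ (fun h => notMem_take_arrivals σ k (List.mem_of_mem_drop h))
        (notMem_drop_arrivals σ k)]
    tauto
  · constructor
    · intro h
      have := (foldl_select_mem _ _ _ _ _ _ h).1
      rw [mem_drop_arrivals] at this
      exact absurd this hk
    · tauto

theorem sampleBest_mem (v : Finset (Fin n) → ℝ) (b : Fin n → ℝ) (B : ℝ) (l : List (Fin n))
    (w : Fin n) (hw : sampleBest v b B l = some w) : w ∈ l ∧ b w ≤ B := by
  have := foldl_invariant (fun s i => (dynkinSample v b B s i).val)
    (fun s => ∀ w, s = some w → w ∈ l ∧ b w ≤ B) l (by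
      intro a ha s hs
      rw [dynkinSample_val]
      split_ifs with h
      · rintro w ⟨⟩
        exact ⟨ha, h.1⟩
      · exact hs) none (by simp)
  exact this w hw

theorem sampleBest_congr {v v' : Finset (Fin n) → ℝ} {b b' : Fin n → ℝ} (B : ℝ)
    {l : List (Fin n)} (hv : ∀ i ∈ l, v {i} = v' {i}) (hb : ∀ i ∈ l, b i = b' i) :
    sampleBest v b B l = sampleBest v' b' B l := by
  -- The invariant keeps the current best agent in `l`, where the two valuations are known to agree.
  refine (foldl_congr_of_invariant _ _ (fun s => ∀ w, s = some w → w ∈ l) l ?_ none (by simp)).1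
  intro a ha s hs
  rw [dynkinSample_val, dynkinSample_val, hb a ha]
  have : BeatsBest v a s ↔ BeatsBest v' a s := by
    refine forall₂_congr fun j hj => ?_
    simp only [Better, hv a ha, hv j (hs j hj)]
  simp only [this, true_and]
  split_ifs
  · rintro w ⟨⟩; exact ha
  · exact hs

theorem selectFirst_congr {v v' : Finset (Fin n) → ℝ} {b b' : Fin n → ℝ} (B : ℝ)
    {best : Option (Fin n)} {l : List (Fin n)} (hv : ∀ i ∈ l, v {i} = v' {i})
    (hbest : ∀ i ∈ best, v {i} = v' {i}) (hb : ∀ i ∈ l, b i = b' i) :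
    selectFirst v b B best l = selectFirst v' b' B best l := by
  refine (foldl_congr_of_invariant _ _ (fun _ => True) l ?_ none trivial).1
  intro a ha s _
  rw [dynkinSelect_val, dynkinSelect_val, hb a ha]
  have : BeatsBest v a best ↔ BeatsBest v' a best := by
    refine forall₂_congr fun j hj => ?_
    simp only [Better, hv a ha, hbest j hj]
  simp [this]

/-! ### The threshold phase -/

/-- The price offered to agent `i` in state `s`. -/
def State.offer (v : Finset (Fin n) → ℝ) (B x : ℝ) (s : State n) (i : Fin n) : ℝ :=
  β * B / x * max (v (insert i (s.S 0)) - v (s.S 0)) (v (insert i (s.S 1)) - v (s.S 1))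

/-- The index of the set that agent `i` may join. -/
def State.target (v : Finset (Fin n) → ℝ) (s : State n) (i : Fin n) : Fin 2 :=
  if v (insert i (s.S 1)) - v (s.S 1) ≤ v (insert i (s.S 0)) - v (s.S 0) then 0 else 1

/-- The condition for agent `i` to be accepted, apart from those on the declared cost. -/
def State.Open (v : Finset (Fin n) → ℝ) (B x : ℝ) (s : State n) (i : Fin n) : Prop :=
  0 < x ∧ s.offer v B x i ≤ s.budget (s.target v i)

/-- Agent `i` is accepted. -/
def State.Accepts (v : Finset (Fin n) → ℝ) (b : Fin n → ℝ) (B x : ℝ) (s : State n)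
    (i : Fin n) : Prop :=
  s.Open v B x i ∧ b i ≤ min (s.offer v B x i) B

/-- The state after agent `i` is accepted. -/
def State.accept (v : Finset (Fin n) → ℝ) (B x : ℝ) (coin : Fin n → Bool) (s : State n)
    (i : Fin n) : State n where
  S := Function.update s.S (s.target v i) (insert i (s.S (s.target v i)))
  T := if coin i then Function.update s.T (s.target v i) (insert i (s.T (s.target v i))) else s.T
  budget := Function.update s.budget (s.target v i) (s.budget (s.target v i) - s.offer v B x i)
  price := Function.update s.price i (s.offer v B x i)

theorem thresholdStep_val (v : Finset (Fin n) → ℝ) (b : Fin n → ℝ) (B x : ℝ)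
    (coin : Fin n → Bool) (s : State n) (i : Fin n) :
    (thresholdStep v b B x coin s i).val =
      if s.Accepts v b B x i then s.accept v B x coin i else s := by
  simp only [thresholdStep, Timed.val_bind]
  by_cases h : B < b i
  · have h2 : ¬ s.Accepts v b B x i := fun hh => by
      have := hh.2.trans (min_le_right _ _)
      linarith
    rw [if_pos h, if_neg h2]
    rfl
  · rw [if_neg h]
    change (if 0 < x ∧ b i ≤ s.offer v B x i ∧ s.offer v B x i ≤ s.budget (s.target v i) then
      (⟨s.accept v B x coin i, _⟩ : Timed (State n)) else ⟨s, _⟩).val = _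
    by_cases h2 : s.Accepts v b B x i
    · rw [if_pos h2, if_pos ⟨h2.1.1, h2.2.trans (min_le_left _ _), h2.1.2⟩]
    · rw [if_neg h2, if_neg]
      rintro ⟨h3, h4, h5⟩
      exact h2 ⟨⟨h3, h5⟩, le_min h4 (not_lt.1 h)⟩

/-- The initial state. -/
def State.init (n : ℕ) (B : ℝ) : State n := ⟨fun _ => ∅, fun _ => ∅, fun _ => B, fun _ => 0⟩

/-- The state after processing the agents in a list. -/
def State.run (v : Finset (Fin n) → ℝ) (b : Fin n → ℝ) (B x : ℝ) (coin : Fin n → Bool)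
    (s : State n) (l : List (Fin n)) : State n :=
  l.foldl (fun s i => (thresholdStep v b B x coin s i).val) s

/-- The output set. -/
def State.output (s : State n) (useT : Bool) (side : Fin 2) : Finset (Fin n) :=
  if useT then s.T side else s.S side

theorem State.output_accept (v : Finset (Fin n) → ℝ) (B x : ℝ) (coin : Fin n → Bool)
    (s : State n) (i a : Fin n) (useT : Bool) (side : Fin 2) :
    a ∈ (s.accept v B x coin i).output useT side ↔
      (a = i ∧ side = s.target v i ∧ (useT → coin i)) ∨ a ∈ s.output useT side := by
  unfold State.output State.accept
  cases useT <;> by_cases h : side = s.target v i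
  · subst h; simp
  · simp [h]
  · subst h; cases coin i <;> simp
  · cases coin i <;> simp [h]

theorem State.run_append (v : Finset (Fin n) → ℝ) (b : Fin n → ℝ) (B x : ℝ) (coin : Fin n → Bool)
    (s : State n) (l₁ l₂ : List (Fin n)) :
    s.run v b B x coin (l₁ ++ l₂) = (s.run v b B x coin l₁).run v b B x coin l₂ := by
  simp [State.run, List.foldl_append]

theorem State.run_cons (v : Finset (Fin n) → ℝ) (b : Fin n → ℝ) (B x : ℝ) (coin : Fin n → Bool)
    (s : State n) (i : Fin n) (l : List (Fin n)) :
    s.run v b B x coin (i :: l) =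
      (if s.Accepts v b B x i then s.accept v B x coin i else s).run v b B x coin l := by
  simp [State.run, thresholdStep_val]

/-- Agents that do not occur in a list are not affected when it is processed. -/
theorem State.run_notMem (v : Finset (Fin n) → ℝ) (b : Fin n → ℝ) (B x : ℝ) (coin : Fin n → Bool)
    (s : State n) (l : List (Fin n)) (i : Fin n) (hi : i ∉ l) (useT : Bool) (side : Fin 2) :
    (i ∈ (s.run v b B x coin l).output useT side ↔ i ∈ s.output useT side) ∧
      (s.run v b B x coin l).price i = s.price i := by
  induction l generalizing s with
  | nil => exact ⟨Iff.rfl, rfl⟩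
  | cons a l ih =>
    rw [List.mem_cons, not_or] at hi
    rw [State.run_cons, (ih _ hi.2).1, (ih _ hi.2).2]
    split_ifs
    · rw [State.output_accept]
      simp [hi.1, State.accept]
    · exact ⟨Iff.rfl, rfl⟩

@[simp] theorem State.output_init (B : ℝ) (useT : Bool) (side : Fin 2) :
    (State.init n B).output useT side = ∅ := by
  simp [State.output, State.init]

theorem State.run_mem (v : Finset (Fin n) → ℝ) (b : Fin n → ℝ) (B x : ℝ) (coin : Fin n → Bool)
    (l₁ l₂ : List (Fin n)) (i : Fin n) (h₁ : i ∉ l₁) (h₂ : i ∉ l₂) (useT : Bool)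
    (side : Fin 2) :
    (i ∈ ((State.init n B).run v b B x coin (l₁ ++ i :: l₂)).output useT side ↔
      ((side = ((State.init n B).run v b B x coin l₁).target v i ∧ (useT → coin i)) ∧
        ((State.init n B).run v b B x coin l₁).Open v B x i) ∧
        b i ≤ min (((State.init n B).run v b B x coin l₁).offer v B x i) B) ∧
    (((State.init n B).run v b B x coin l₁).Accepts v b B x i →
      ((State.init n B).run v b B x coin (l₁ ++ i :: l₂)).price i =
        ((State.init n B).run v b B x coin l₁).offer v B x i) := by
  have h3 := (State.run_notMem v b B x coin (State.init n B) l₁ i h₁ useT side).1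
  rw [State.output_init] at h3
  rw [State.run_append, State.run_cons]
  set s := (State.init n B).run v b B x coin l₁
  constructor
  · rw [(State.run_notMem v b B x coin _ l₂ i h₂ useT side).1]
    by_cases ha : s.Accepts v b B x i
    · rw [if_pos ha, State.output_accept, h3]
      simp [ha.1, ha.2]
    · rw [if_neg ha, h3]
      simp only [Finset.notMem_empty, false_iff]
      exact fun hh => ha ⟨hh.1.2, hh.2⟩
  · intro ha
    rw [(State.run_notMem v b B x coin _ l₂ i h₂ useT side).2, if_pos ha]
    simp [State.accept]

/-- As long as `S_j ⊆ P`, all queries concern subsets of `P`; the inclusion is therefore carried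
along and also returned. -/
theorem State.run_congr {v v' : Finset (Fin n) → ℝ} {b b' : Fin n → ℝ} {B x : ℝ}
    {coin : Fin n → Bool} {l : List (Fin n)} {P : Finset (Fin n)} (hl : ∀ i ∈ l, i ∈ P)
    (hv : ∀ S ⊆ P, v S = v' S) (hb : ∀ i ∈ l, b i = b' i) :
    (State.init n B).run v b B x coin l = (State.init n B).run v' b' B x coin l ∧
      ∀ j, ((State.init n B).run v b B x coin l).S j ⊆ P := by
  refine foldl_congr_of_invariant _ _ (fun s : State n => ∀ j, s.S j ⊆ P) l ?_ _
    (by simp [State.init])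
  intro a ha s hs
  have hins : ∀ j, insert a (s.S j) ⊆ P := fun j => Finset.insert_subset (hl a ha) (hs j)
  have ht : s.target v a = s.target v' a := by
    simp only [State.target, hv _ (hins _), hv _ (hs _)]
  have ho : s.offer v B x a = s.offer v' B x a := by
    simp only [State.offer, hv _ (hins _), hv _ (hs _)]
  rw [thresholdStep_val, thresholdStep_val]
  constructor
  · have h1 : s.Accepts v b B x a ↔ s.Accepts v' b' B x a := by
      simp only [State.Accepts, State.Open, ht, ho, hb a ha]
    have h2 : s.accept v B x coin a = s.accept v' B x coin a := by
      simp only [State.accept, ht, ho]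
    simp only [h1, h2]
  · split_ifs
    · intro j
      simp only [State.accept]
      by_cases h : j = s.target v a
      · subst h; simpa using hins _
      · simpa [h] using hs j
    · exact hs

/-! ### The mechanism -/

/-- The length of the sample of the threshold phase. -/
def Seed.heads (ρ : Seed n Ω) : ℕ := (Finset.univ.filter fun i => ρ.split i = true).card

/-- The affordable agents of the sample. -/
def sampleSet (b : Fin n → ℝ) (B : ℝ) (l : List (Fin n)) : Finset (Fin n) :=
  l.toFinset.filter fun i => b i ≤ B

/-- The value of the solution found in the sample. -/
def estimate (alg : KnapsackAlg n Ω) (v : Finset (Fin n) → ℝ) (b : Fin n → ℝ) (B : ℝ)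
    (X : Finset (Fin n)) (ω : Ω) : ℝ :=
  v ((alg X (fun S => v (S.map (Function.Embedding.subtype _))) (fun i => b i) B ω).val.map
    (Function.Embedding.subtype _))

/-- The subroutine receives only the restrictions of the valuation and of the costs to `X`, hence
cannot depend on anything outside the sample. -/
theorem estimate_congr (alg : KnapsackAlg n Ω) {v v' : Finset (Fin n) → ℝ} {b b' : Fin n → ℝ}
    (B : ℝ) {X : Finset (Fin n)} (ω : Ω) (hv : ∀ S ⊆ X, v S = v' S) (hb : ∀ i ∈ X, b i = b' i) :
    estimate alg v b B X ω = estimate alg v' b' B X ω := by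
  have h1 : (fun S : Finset X => v (S.map (Function.Embedding.subtype _))) =
      fun S : Finset X => v' (S.map (Function.Embedding.subtype _)) := by
    funext S
    refine hv _ fun i hi => ?_
    obtain ⟨j, _, rfl⟩ := Finset.mem_map.1 hi
    exact j.2
  have h2 : (fun i : X => b i) = fun i : X => b' i := funext fun i => hb i i.2
  unfold estimate
  rw [congrFun h1 _, h1, h2]

/-- The final state of the threshold phase. -/
def finalState (alg : KnapsackAlg n Ω) (v : Finset (Fin n) → ℝ) (b : Fin n → ℝ) (B : ℝ)
    (σ : Equiv.Perm (Fin n)) (ρ : Seed n Ω) : State n :=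
  (State.init n B).run v b B
    (estimate alg v b B (sampleSet b B ((arrivals σ).take ρ.heads)) ρ.sub) ρ.coin
    ((arrivals σ).drop ρ.heads)

theorem genSmOnline_val (alg : KnapsackAlg n Ω) (v : Finset (Fin n) → ℝ) (b : Fin n → ℝ) (B : ℝ)
    (σ : Equiv.Perm (Fin n)) (ρ : Seed n Ω) :
    (genSmOnline alg v b B σ ρ).val =
      if ρ.dynkin then ((dynkinWinner v b B σ).toFinset,
        fun i => if dynkinWinner v b B σ = some i then B else 0)
      else ((finalState alg v b B σ ρ).output ρ.useT ρ.side,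
        fun i => if i ∈ (finalState alg v b B σ ρ).output ρ.useT ρ.side
          then (finalState alg v b B σ ρ).price i else 0) := by
  cases h : ρ.dynkin
  · simp only [genSmOnline, h, Timed.val_bind, Bool.false_eq_true, if_false, Timed.val_pure,
      Timed.val_foldlM]
    rfl
  · simp only [genSmOnline, h, Timed.val_bind, if_true]
    exact dynkin_val v b B σ

/-- The selected set. -/
def selected (alg : KnapsackAlg n Ω) (v : Finset (Fin n) → ℝ) (B : ℝ)
    (σ : Equiv.Perm (Fin n)) (ρ : Seed n Ω) (b : Fin n → ℝ) : Finset (Fin n) :=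
  (genSmOnline alg v b B σ ρ).val.1

theorem genSmMechanism_eq (alg : KnapsackAlg n Ω) (v : Finset (Fin n) → ℝ) (B : ℝ)
    (σ : Equiv.Perm (Fin n)) (ρ : Seed n Ω) :
    genSmMechanism alg B ρ v σ = thresholdMechanism (selected alg v B σ ρ) := rfl

theorem selected_dynkin (alg : KnapsackAlg n Ω) (v : Finset (Fin n) → ℝ) (B : ℝ)
    (σ : Equiv.Perm (Fin n)) (ρ : Seed n Ω) (b : Fin n → ℝ) (h : ρ.dynkin = true) :
    selected alg v B σ ρ b = (dynkinWinner v b B σ).toFinset := by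
  simp [selected, genSmOnline_val, h]

theorem selected_threshold (alg : KnapsackAlg n Ω) (v : Finset (Fin n) → ℝ) (B : ℝ)
    (σ : Equiv.Perm (Fin n)) (ρ : Seed n Ω) (b : Fin n → ℝ) (h : ρ.dynkin = false) :
    selected alg v B σ ρ b = (finalState alg v b B σ ρ).output ρ.useT ρ.side := by
  simp [selected, genSmOnline_val, h]

/-- The state of the threshold phase before the arrival of the agent in position `k`. -/
def stateBefore (alg : KnapsackAlg n Ω) (v : Finset (Fin n) → ℝ) (b : Fin n → ℝ) (B : ℝ)
    (σ : Equiv.Perm (Fin n)) (ρ : Seed n Ω) (k : Fin n) : State n :=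
  (State.init n B).run v b B
    (estimate alg v b B (sampleSet b B ((arrivals σ).take ρ.heads)) ρ.sub) ρ.coin
    (((arrivals σ).take k).drop ρ.heads)

/-- The counterpart of `dynkinWinner_eq_some`. The posted price is capped at `B` because higher
declarations are rejected on arrival. -/
theorem mem_selected_threshold (alg : KnapsackAlg n Ω) (v : Finset (Fin n) → ℝ) (B : ℝ)
    (σ : Equiv.Perm (Fin n)) (ρ : Seed n Ω) (b : Fin n → ℝ) (h : ρ.dynkin = false) (k : Fin n) :
    σ k ∈ selected alg v B σ ρ b ↔
      (ρ.heads ≤ k ∧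
        (ρ.side = (stateBefore alg v b B σ ρ k).target v (σ k) ∧ (ρ.useT → ρ.coin (σ k))) ∧
        (stateBefore alg v b B σ ρ k).Open v B
          (estimate alg v b B (sampleSet b B ((arrivals σ).take ρ.heads)) ρ.sub) (σ k)) ∧
      b (σ k) ≤ min ((stateBefore alg v b B σ ρ k).offer v B
          (estimate alg v b B (sampleSet b B ((arrivals σ).take ρ.heads)) ρ.sub) (σ k)) B := by
  rw [selected_threshold alg v B σ ρ b h]
  by_cases hk : ρ.heads ≤ k
  · rw [finalState, drop_arrivals_eq σ _ k hk, (State.run_mem _ _ _ _ _ _ _ _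
      (fun h => notMem_take_arrivals σ k (List.mem_of_mem_drop h)) (notMem_drop_arrivals σ k)
      _ _).1]
    simp only [hk, true_and, stateBefore]
  · have h2 : σ k ∉ (arrivals σ).drop ρ.heads := by rwa [mem_drop_arrivals]
    rw [finalState, (State.run_notMem _ _ _ _ _ _ _ _ h2 _ _).1]
    simp [hk]

theorem sampleSet_congr {b b' : Fin n → ℝ} (B : ℝ) {l : List (Fin n)}
    (hb : ∀ i ∈ l, b i = b' i) : sampleSet b B l = sampleSet b' B l := by
  ext i
  simp only [sampleSet, Finset.mem_filter, List.mem_toFinset]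
  constructor <;> rintro ⟨h1, h2⟩ <;> refine ⟨h1, ?_⟩ <;> have := hb i h1 <;> linarith

/-- The data of the arrivals in positions before `t` determine the state. -/
theorem stateBefore_congr (alg : KnapsackAlg n Ω) {v v' : Finset (Fin n) → ℝ} {b b' : Fin n → ℝ}
    (B : ℝ) {σ σ' : Equiv.Perm (Fin n)} (ρ : Seed n Ω) (k : Fin n)
    (hσ : ∀ j : Fin n, (j : ℕ) < k → σ j = σ' j) (hb : ∀ j : Fin n, (j : ℕ) < k → b (σ j) = b' (σ j))
    (hv : ∀ S : Finset (Fin n), (∀ i ∈ S, ∃ j : Fin n, (j : ℕ) < k ∧ σ j = i) → v S = v' S)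
    (hk : ρ.heads ≤ k) :
    estimate alg v b B (sampleSet b B ((arrivals σ).take ρ.heads)) ρ.sub =
      estimate alg v' b' B (sampleSet b' B ((arrivals σ').take ρ.heads)) ρ.sub ∧
    stateBefore alg v b B σ ρ k = stateBefore alg v' b' B σ' ρ k ∧
    ∀ j, ∀ i ∈ (stateBefore alg v b B σ ρ k).S j, ∃ m : Fin n, (m : ℕ) < k ∧ σ m = i := by
  have hex : ∀ i ∈ (arrivals σ).take k, ∃ j : Fin n, (j : ℕ) < k ∧ σ j = i := by
    intro i hi
    refine ⟨σ.symm i, ?_, by simp⟩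
    rw [← mem_take_arrivals σ]
    simpa using hi
  have hb' : ∀ i ∈ (arrivals σ).take k, b i = b' i := by
    intro i hi
    obtain ⟨j, hj, rfl⟩ := hex i hi
    exact hb j hj
  have hsub : ∀ i ∈ (arrivals σ).take ρ.heads, i ∈ (arrivals σ).take k :=
    fun i hi => List.take_subset_take_left _ hk hi
  have hest : estimate alg v b B (sampleSet b B ((arrivals σ).take ρ.heads)) ρ.sub =
      estimate alg v' b' B (sampleSet b' B ((arrivals σ').take ρ.heads)) ρ.sub := by
    rw [← take_arrivals_congr hσ hk, ← sampleSet_congr B (fun i hi => hb' i (hsub i hi))]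
    apply estimate_congr
    · intro S hS
      refine hv S fun i hi => hex i (hsub i ?_)
      have := hS hi
      simp only [sampleSet, Finset.mem_filter, List.mem_toFinset] at this
      exact this.1
    · intro i hi
      simp only [sampleSet, Finset.mem_filter, List.mem_toFinset] at hi
      exact hb' i (hsub i hi.1)
  have hrun := State.run_congr (v := v) (v' := v') (b := b) (b' := b') (B := B)
    (x := estimate alg v b B (sampleSet b B ((arrivals σ).take ρ.heads)) ρ.sub) (coin := ρ.coin)
    (l := ((arrivals σ).take k).drop ρ.heads) (P := ((arrivals σ).take k).toFinset)
    (fun i hi => by simpa using List.mem_of_mem_drop hi)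
    (fun S hS => hv S fun i hi => hex i (by simpa using hS hi))
    (fun i hi => hb' i (List.mem_of_mem_drop hi))
  refine ⟨hest, ?_, ?_⟩
  · rw [stateBefore, stateBefore, ← hest, ← take_arrivals_congr hσ le_rfl]
    exact hrun.1
  · intro j i hi
    exact hex i (by simpa using hrun.2 j hi)

/-- The state met by `σ k` depends on strictly earlier positions (`stateBefore_congr`); position `k`
itself enters through her declaration and through queries of sets containing her. -/
theorem mem_selected_congr (alg : KnapsackAlg n Ω) {v v' : Finset (Fin n) → ℝ}
    {b b' : Fin n → ℝ} (B : ℝ) {σ σ' : Equiv.Perm (Fin n)} (ρ : Seed n Ω) (k : Fin n)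
    (hσ : ∀ j : Fin n, j ≤ k → σ j = σ' j) (hb : ∀ j : Fin n, j ≤ k → b (σ j) = b' (σ j))
    (hv : ∀ S : Finset (Fin n), (∀ i ∈ S, ∃ j : Fin n, j ≤ k ∧ σ j = i) → v S = v' S) :
    σ k ∈ selected alg v B σ ρ b ↔ σ k ∈ selected alg v' B σ' ρ b' := by
  have hσ' : ∀ j : Fin n, (j : ℕ) < k → σ j = σ' j := fun j hj => hσ j (le_of_lt hj)
  have hv1 : ∀ j : Fin n, j ≤ k → v {σ j} = v' {σ j} := by
    intro j hj
    refine hv _ fun i hi => ⟨j, hj, ?_⟩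
    rw [Finset.mem_singleton] at hi
    exact hi.symm
  rw [hσ k le_rfl]
  cases hd : ρ.dynkin
  · rw [← hσ k le_rfl, mem_selected_threshold alg v B σ ρ b hd k]
    conv_rhs => rw [hσ k le_rfl, mem_selected_threshold alg v' B σ' ρ b' hd k, ← hσ k le_rfl]
    by_cases hk : ρ.heads ≤ k
    · obtain ⟨h1, h2, h3⟩ := stateBefore_congr alg B ρ k hσ' (fun j hj => hb j (le_of_lt hj))
        (fun S hS => hv S fun i hi => by
          obtain ⟨j, hj, h⟩ := hS i hi
          exact ⟨j, le_of_lt hj, h⟩) hk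
      rw [← h1, ← h2, ← hb k le_rfl]
      set s := stateBefore alg v b B σ ρ k
      have e1 : ∀ j, v (s.S j) = v' (s.S j) := fun j => hv _ fun i hi => by
        obtain ⟨m, hm, h⟩ := h3 j i hi
        exact ⟨m, le_of_lt hm, h⟩
      have e2 : ∀ j, v (insert (σ k) (s.S j)) = v' (insert (σ k) (s.S j)) := fun j =>
        hv _ fun i hi => by
          rcases Finset.mem_insert.1 hi with rfl | hi
          · exact ⟨k, le_rfl, rfl⟩
          · obtain ⟨m, hm, h⟩ := h3 j i hi
            exact ⟨m, le_of_lt hm, h⟩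
      simp only [State.Open, State.target, State.offer, e1, e2]
    · simp [hk]
  · rw [← hσ k le_rfl, selected_dynkin _ _ _ _ _ _ hd, selected_dynkin _ _ _ _ _ _ hd,
      Option.mem_toFinset, Option.mem_toFinset, Option.mem_def, Option.mem_def,
      dynkinWinner_eq_some]
    conv_rhs => rw [hσ k le_rfl, dynkinWinner_eq_some, ← hσ k le_rfl]
    by_cases hk : sampleSize n ≤ k
    · have hmem : ∀ i ∈ (arrivals σ).take k, b i = b' i ∧ v {i} = v' {i} := by
        intro i hi
        have : ((σ.symm i : Fin n) : ℕ) < k := by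
          rw [← mem_take_arrivals σ]
          simpa using hi
        have h1 := hb _ (le_of_lt this)
        have h2 := hv1 _ (le_of_lt this)
        simp only [Equiv.apply_symm_apply] at h1 h2
        exact ⟨h1, h2⟩
      have hsub : ∀ i ∈ (arrivals σ).take (sampleSize n), i ∈ (arrivals σ).take k :=
        fun i hi => List.take_subset_take_left _ hk hi
      have hbest := sampleBest_congr (v := v) (v' := v') (b := b) (b' := b') B
        (l := (arrivals σ).take (sampleSize n)) (fun i hi => (hmem i (hsub i hi)).2)
        (fun i hi => (hmem i (hsub i hi)).1)
      rw [← take_arrivals_congr hσ' hk, ← take_arrivals_congr hσ' le_rfl, ← hbest, ← hb k le_rfl]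
      have hbv : ∀ i ∈ sampleBest v b B ((arrivals σ).take (sampleSize n)), v {i} = v' {i} :=
        fun i hi => (hmem i (hsub i (sampleBest_mem _ _ _ _ _ hi).1)).2
      rw [selectFirst_congr (v' := v') (b' := b') B
        (fun i hi => (hmem i (List.mem_of_mem_drop hi)).2) hbv
        (fun i hi => (hmem i (List.mem_of_mem_drop hi)).1)]
      have : BeatsBest v (σ k) (sampleBest v b B ((arrivals σ).take (sampleSize n))) ↔
          BeatsBest v' (σ k) (sampleBest v b B ((arrivals σ).take (sampleSize n))) := by
        refine forall₂_congr fun j hj => ?_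
        simp only [Better, hv1 k le_rfl, hbv j hj]
      rw [this]
    · simp [hk]

theorem isOnline_genSmMechanism (alg : KnapsackAlg n Ω) (B : ℝ) (ρ : Seed n Ω) :
    IsOnline (genSmMechanism alg B ρ) := by
  intro t v v' σ σ' b b' hb hv k hk
  simp only [genSmMechanism_eq, thresholdMechanism]
  have hlt : ∀ j : Fin n, j ≤ k → (j : ℕ) < t := fun j hj => lt_of_le_of_lt hj hk
  have key : ∀ d d' : Fin n → ℝ, (∀ j : Fin n, j ≤ k → d (σ j) = d' (σ j)) →
      (σ k ∈ selected alg v B σ ρ d ↔ σ k ∈ selected alg v' B σ' ρ d') := by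
    intro d d' hd
    refine mem_selected_congr alg B ρ k (fun j hj => (hb j (hlt j hj)).1) hd fun S hS => ?_
    refine hv S fun i hi => ?_
    obtain ⟨j, hj, h⟩ := hS i hi
    exact ⟨j, hlt j hj, h⟩
  have key0 := key b b' fun j hj => (hb j (hlt j hj)).2
  refine ⟨key0, ?_⟩
  unfold thresholdPayment
  -- The threshold refers to hypothetical declarations of `σ k` only, and changing both profiles in
  -- this way preserves their agreement.
  have : {u | b (σ k) ≤ u ∧ σ k ∈ selected alg v B σ ρ (Function.update b (σ k) u)} =
      {u | b' (σ k) ≤ u ∧ σ k ∈ selected alg v' B σ' ρ (Function.update b' (σ k) u)} := by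
    ext u
    simp only [Set.mem_ofPred_eq]
    rw [(hb k hk).2, key (Function.update b (σ k) u) (Function.update b' (σ k) u)]
    intro j hj
    by_cases h : σ j = σ k
    · rw [h]; simp
    · simp [h, (hb j (hlt j hj)).2]
  rw [this]
  simp only [key0]

/-! ### Truthfulness, payments and budget-feasibility -/

theorem update_apply_of_lt (σ : Equiv.Perm (Fin n)) (b : Fin n → ℝ) (k : Fin n) (t : ℝ)
    (j : Fin n) (hj : j < k) : Function.update b (σ k) t (σ j) = b (σ j) := by
  rw [Function.update_of_ne]
  exact fun h => hj.ne (σ.injective h)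

theorem isPosted_dynkin (alg : KnapsackAlg n Ω) (v : Finset (Fin n) → ℝ) (B : ℝ)
    (σ : Equiv.Perm (Fin n)) (ρ : Seed n Ω) (b : Fin n → ℝ) (h : ρ.dynkin = true) (k : Fin n) :
    ∃ Q, IsPosted (selected alg v B σ ρ) b (σ k) B Q := by
  refine ⟨sampleSize n ≤ k ∧
    selectFirst v b B (sampleBest v b B ((arrivals σ).take (sampleSize n)))
      (((arrivals σ).take k).drop (sampleSize n)) = none ∧
    BeatsBest v (σ k) (sampleBest v b B ((arrivals σ).take (sampleSize n))), fun t => ?_⟩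
  rw [selected_dynkin _ _ _ _ _ _ h, Option.mem_toFinset, Option.mem_def, dynkinWinner_eq_some,
    Function.update_self]
  refine and_congr_left' (and_congr_right fun hk => ?_)
  have hmem : ∀ i ∈ (arrivals σ).take k, Function.update b (σ k) t i = b i := by
    intro i hi
    rw [Function.update_of_ne]
    rintro rfl
    exact notMem_take_arrivals σ k hi
  rw [sampleBest_congr B (fun _ _ => rfl)
      fun i hi => hmem i (List.take_subset_take_left _ hk hi),
    selectFirst_congr B (fun _ _ => rfl) (fun _ _ => rfl)
      fun i hi => hmem i (List.mem_of_mem_drop hi)]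

/-- Estimate and state before position `k` do not see the declaration of `σ k`. If she belongs to
the sample they might, but then she is never selected. -/
theorem isPosted_threshold (alg : KnapsackAlg n Ω) (v : Finset (Fin n) → ℝ) (B : ℝ)
    (σ : Equiv.Perm (Fin n)) (ρ : Seed n Ω) (b : Fin n → ℝ) (h : ρ.dynkin = false) (k : Fin n) :
    ∃ Q, IsPosted (selected alg v B σ ρ) b (σ k)
      (min ((stateBefore alg v b B σ ρ k).offer v B
        (estimate alg v b B (sampleSet b B ((arrivals σ).take ρ.heads)) ρ.sub) (σ k)) B) Q := by
  refine ⟨ρ.heads ≤ k ∧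
    (ρ.side = (stateBefore alg v b B σ ρ k).target v (σ k) ∧ (ρ.useT → ρ.coin (σ k))) ∧
      (stateBefore alg v b B σ ρ k).Open v B
        (estimate alg v b B (sampleSet b B ((arrivals σ).take ρ.heads)) ρ.sub) (σ k), fun t => ?_⟩
  rw [mem_selected_threshold _ _ _ _ _ _ h, Function.update_self]
  by_cases hk : ρ.heads ≤ k
  · obtain ⟨h1, h2, _⟩ := stateBefore_congr alg (v := v) (v' := v) (b := Function.update b (σ k) t)
      (b' := b) B (σ := σ) (σ' := σ) ρ k (fun _ _ => rfl)
      (fun j hj => update_apply_of_lt σ b k t j hj) (fun _ _ => rfl) hk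
    rw [h1, h2]
  · simp only [hk, false_and]

theorem exists_isPosted (alg : KnapsackAlg n Ω) (v : Finset (Fin n) → ℝ) (B : ℝ)
    (σ : Equiv.Perm (Fin n)) (ρ : Seed n Ω) (b : Fin n → ℝ) (i : Fin n) :
    ∃ p Q, IsPosted (selected alg v B σ ρ) b i p Q := by
  obtain ⟨k, rfl⟩ := σ.surjective i
  cases h : ρ.dynkin
  · exact ⟨_, isPosted_threshold alg v B σ ρ b h k⟩
  · exact ⟨_, isPosted_dynkin alg v B σ ρ b h k⟩

/-- Invariants of the threshold phase that may refer to the set of agents processed so far. -/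
theorem State.run_invariant {v : Finset (Fin n) → ℝ} {b : Fin n → ℝ} {B x : ℝ}
    {coin : Fin n → Bool} (I : Finset (Fin n) → State n → Prop) {l : List (Fin n)}
    (hl : l.Nodup) (h0 : I ∅ (State.init n B))
    (hrej : ∀ P s i, i ∈ l → i ∉ P → I P s → ¬ s.Accepts v b B x i → I (insert i P) s)
    (hacc : ∀ P s i, i ∈ l → i ∉ P → I P s → s.Accepts v b B x i →
      I (insert i P) (s.accept v B x coin i)) :
    I l.toFinset ((State.init n B).run v b B x coin l) := by
  suffices H : ∀ (l' : List (Fin n)) (P : Finset (Fin n)) (s : State n), l'.Nodup →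
      (∀ i ∈ l', i ∈ l) → (∀ i ∈ l', i ∉ P) → I P s →
      I (P ∪ l'.toFinset) (s.run v b B x coin l') by
    simpa using H l ∅ _ hl (fun _ h => h) (fun i _ => by simp) h0
  intro l'
  induction l' with
  | nil => intro P s _ _ _ h; simpa [State.run] using h
  | cons a l' ih =>
    intro P s hn hsub hP hI
    rw [List.nodup_cons] at hn
    rw [State.run_cons, List.toFinset_cons, Finset.union_insert, ← Finset.insert_union]
    apply ih _ _ hn.2 (fun i hi => hsub i (by simp [hi]))
    · intro i hi
      rw [Finset.mem_insert, not_or]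
      refine ⟨?_, hP i (by simp [hi])⟩
      rintro rfl
      exact hn.1 hi
    · split_ifs with hc
      · exact hacc P s a (hsub a (by simp)) (hP a (by simp)) hI hc
      · exact hrej P s a (hsub a (by simp)) (hP a (by simp)) hI hc

/-- Bookkeeping of the threshold phase: the budgets account for the prices paid. -/
structure State.Balanced (B : ℝ) (P : Finset (Fin n)) (s : State n) : Prop where
  S_subset : ∀ j, s.S j ⊆ P
  T_subset : ∀ j, s.T j ⊆ s.S j
  budget_nonneg : ∀ j, 0 ≤ s.budget j
  balance : ∀ j, s.budget j + ∑ i ∈ s.S j, s.price i = B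
  price_nonneg : ∀ i, 0 ≤ s.price i

theorem State.Balanced.budget_le {B : ℝ} {P : Finset (Fin n)} {s : State n}
    (h : s.Balanced B P) (j : Fin 2) : s.budget j ≤ B := by
  have := h.balance j
  have h2 : 0 ≤ ∑ i ∈ s.S j, s.price i := Finset.sum_nonneg fun i _ => h.price_nonneg i
  linarith

/-- An accepted offer lies between the declared cost, hence zero, and the remaining budget. The new
agent has not been processed before, so recording her price leaves the old sums intact. -/
theorem State.balanced_run (v : Finset (Fin n) → ℝ) {b : Fin n → ℝ} (hb : ∀ i, 0 ≤ b i) {B : ℝ}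
    (hB : 0 ≤ B) (x : ℝ) (coin : Fin n → Bool) {l : List (Fin n)} (hl : l.Nodup) :
    ((State.init n B).run v b B x coin l).Balanced B l.toFinset := by
  apply State.run_invariant (fun P s => s.Balanced B P) hl
  · constructor <;> simp [State.init, hB]
  · intro P s i _ _ h _
    exact ⟨fun j => (h.S_subset j).trans (Finset.subset_insert _ _), h.T_subset, h.budget_nonneg,
      h.balance, h.price_nonneg⟩
  · intro P s i _ hi h hacc
    have hiS : ∀ j, i ∉ s.S j := fun j hj => hi (h.S_subset j hj)
    have hoff : 0 ≤ s.offer v B x i := (hb i).trans (hacc.2.trans (min_le_left _ _))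
    have hsum : ∀ j, ∑ a ∈ s.S j, Function.update s.price i (s.offer v B x i) a =
        ∑ a ∈ s.S j, s.price a := fun j => Finset.sum_congr rfl fun a ha => by
      rw [Function.update_of_ne]
      rintro rfl
      exact hiS j ha
    constructor
    · intro j
      by_cases hj : j = s.target v i
      · subst hj
        simpa [State.accept] using Finset.insert_subset_insert i (h.S_subset _)
      · simpa [State.accept, hj] using (h.S_subset j).trans (Finset.subset_insert _ _)
    · intro j
      have h1 := h.T_subset j
      by_cases hj : j = s.target v i
      · subst hj
        cases hc : coin i
        · simpa [State.accept, hc] using h1.trans (Finset.subset_insert _ _)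
        · simpa [State.accept, hc] using Finset.insert_subset_insert i h1
      · cases hc : coin i <;> simpa [State.accept, hc, hj] using h1
    · intro j
      by_cases hj : j = s.target v i
      · subst hj
        simpa [State.accept] using hacc.1.2
      · simpa [State.accept, hj] using h.budget_nonneg j
    · intro j
      have h1 := h.balance j
      by_cases hj : j = s.target v i
      · subst hj
        simp only [State.accept, Function.update_self]
        rw [Finset.sum_insert (hiS _), Function.update_self, hsum]
        linarith
      · simp only [State.accept, Function.update_of_ne hj, hsum]
        exact h1
    · intro a
      by_cases ha : a = i
      · subst ha; simpa [State.accept] using hoff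
      · simpa [State.accept, ha] using h.price_nonneg a

theorem balanced_finalState (alg : KnapsackAlg n Ω) (v : Finset (Fin n) → ℝ) {b : Fin n → ℝ}
    (hb : ∀ i, 0 ≤ b i) {B : ℝ} (hB : 0 ≤ B) (σ : Equiv.Perm (Fin n)) (ρ : Seed n Ω) :
    (finalState alg v b B σ ρ).Balanced B ((arrivals σ).drop ρ.heads).toFinset :=
  State.balanced_run v hb hB _ _ ((nodup_arrivals σ).sublist (List.drop_sublist _ _))

theorem balanced_stateBefore (alg : KnapsackAlg n Ω) (v : Finset (Fin n) → ℝ) {b : Fin n → ℝ}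
    (hb : ∀ i, 0 ≤ b i) {B : ℝ} (hB : 0 ≤ B) (σ : Equiv.Perm (Fin n)) (ρ : Seed n Ω)
    (k : Fin n) :
    (stateBefore alg v b B σ ρ k).Balanced B (((arrivals σ).take k).drop ρ.heads).toFinset :=
  State.balanced_run v hb hB _ _
    ((nodup_arrivals σ).sublist ((List.drop_sublist _ _).trans (List.take_sublist _ _)))

/-- The recorded price is the threshold: an open offer is at most the remaining budget, hence at
most `B`, so the cap in the posted price is inactive. -/
theorem genSmOnline_payment (alg : KnapsackAlg n Ω) (v : Finset (Fin n) → ℝ) {b : Fin n → ℝ}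
    (hb : ∀ i, 0 ≤ b i) {B : ℝ} (hB : 0 ≤ B) (σ : Equiv.Perm (Fin n)) (ρ : Seed n Ω) :
    (genSmOnline alg v b B σ ρ).val.2 = thresholdPayment (selected alg v B σ ρ) b := by
  funext i
  obtain ⟨k, rfl⟩ := σ.surjective i
  cases h : ρ.dynkin
  · obtain ⟨Q, hQ⟩ := isPosted_threshold alg v B σ ρ b h k
    have h1 := hQ.thresholdPayment_eq (b (σ k))
    have h2 := hQ (b (σ k))
    rw [Function.update_eq_self] at h1 h2
    rw [h1, genSmOnline_val]
    simp only [h, Bool.false_eq_true, if_false]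
    rw [← selected_threshold _ _ _ _ _ _ h]
    by_cases hw : σ k ∈ selected alg v B σ ρ b
    · rw [if_pos hw, if_pos (h2.1 hw)]
      have hw' := (mem_selected_threshold alg v B σ ρ b h k).1 hw
      have hprice := (State.run_mem v b B
        (estimate alg v b B (sampleSet b B ((arrivals σ).take ρ.heads)) ρ.sub) ρ.coin
        (((arrivals σ).take k).drop ρ.heads) ((arrivals σ).drop (k + 1)) (σ k)
        (fun h => notMem_take_arrivals σ k (List.mem_of_mem_drop h)) (notMem_drop_arrivals σ k)
        ρ.useT ρ.side).2 ⟨hw'.1.2.2, hw'.2⟩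
      rw [finalState, drop_arrivals_eq σ _ k hw'.1.1, hprice]
      refine (min_eq_left ?_).symm
      exact hw'.1.2.2.2.trans ((balanced_stateBefore alg v hb hB σ ρ k).budget_le _)
    · rw [if_neg hw, if_neg (fun hh => hw (h2.2 hh))]
  · obtain ⟨Q, hQ⟩ := isPosted_dynkin alg v B σ ρ b h k
    have h1 := hQ.thresholdPayment_eq (b (σ k))
    have h2 := hQ (b (σ k))
    rw [Function.update_eq_self] at h1 h2
    rw [h1, genSmOnline_val]
    simp only [h, if_true]
    rw [selected_dynkin _ _ _ _ _ _ h, Option.mem_toFinset, Option.mem_def] at h2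
    simp only [h2]

theorem isBudgetFeasible_threshold (alg : KnapsackAlg n Ω) (v : Finset (Fin n) → ℝ) {B : ℝ}
    (hB : 0 ≤ B) (σ : Equiv.Perm (Fin n)) (ρ : Seed n Ω) :
    (thresholdMechanism (selected alg v B σ ρ)).IsBudgetFeasible B := by
  intro b hb
  simp only [thresholdMechanism, ← genSmOnline_payment alg v hb hB σ ρ, genSmOnline_val]
  cases h : ρ.dynkin
  · simp only [Bool.false_eq_true, if_false]
    have hbal := balanced_finalState alg v hb hB σ ρ
    set s := finalState alg v b B σ ρ
    have hsub : s.output ρ.useT ρ.side ⊆ s.S ρ.side := by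
      unfold State.output
      split_ifs
      · exact hbal.T_subset _
      · exact subset_rfl
    rw [← Finset.sum_filter, Finset.filter_mem_eq_inter, Finset.univ_inter]
    have h1 := Finset.sum_le_sum_of_subset_of_nonneg hsub fun i _ _ => hbal.price_nonneg i
    have h2 := hbal.balance ρ.side
    have h3 := hbal.budget_nonneg ρ.side
    linarith
  · simp only [if_true]
    rcases dynkinWinner v b B σ with _ | w
    · simpa using hB
    · simp

/-! ### Running time -/

theorem beats_steps_le (v : Finset (Fin n) → ℝ) (i : Fin n) (best : Option (Fin n)) :
    (beats v i best).steps ≤ 5 := by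
  cases best <;> simp [beats]

theorem dynkinSample_steps_le (v : Finset (Fin n) → ℝ) (b : Fin n → ℝ) (B : ℝ)
    (best : Option (Fin n)) (i : Fin n) : (dynkinSample v b B best i).steps ≤ 7 := by
  have h := beats_steps_le v i best
  simp only [dynkinSample, Timed.steps_bind, tick_steps]
  split_ifs <;> simp <;> split_ifs <;> simp <;> omega

theorem dynkinSelect_steps_le (v : Finset (Fin n) → ℝ) (b : Fin n → ℝ) (B : ℝ)
    (best winner : Option (Fin n)) (i : Fin n) :
    (dynkinSelect v b B best winner i).steps ≤ 8 := by
  have h := beats_steps_le v i best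
  simp only [dynkinSelect, Timed.steps_bind, tick_steps]
  split_ifs <;> simp <;> split_ifs <;> simp <;> omega

theorem dynkin_steps_le (v : Finset (Fin n) → ℝ) (b : Fin n → ℝ) (B : ℝ)
    (σ : Equiv.Perm (Fin n)) : (dynkin v b B σ).steps ≤ 16 * n + 2 := by
  simp only [dynkin, Timed.steps_bind, tick_steps, Timed.steps_pure]
  have h1 := Timed.steps_foldlM_le _ 7 (dynkinSample_steps_le v b B) none
    ((arrivals σ).take ⌊(n : ℝ) / Real.exp 1⌋₊)
  have h2 := Timed.steps_foldlM_le _ 8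
    (dynkinSelect_steps_le v b B (((arrivals σ).take ⌊(n : ℝ) / Real.exp 1⌋₊).foldlM
      (dynkinSample v b B) none).val) none ((arrivals σ).drop ⌊(n : ℝ) / Real.exp 1⌋₊)
  simp only [List.length_take, List.length_drop, length_arrivals] at h1 h2
  omega

/-- The count is `1 + 4 + 4 + 8 + 6`, with `4` for each marginal value. -/
theorem thresholdStep_steps_le (v : Finset (Fin n) → ℝ) (b : Fin n → ℝ) (B x : ℝ)
    (coin : Fin n → Bool) (s : State n) (i : Fin n) :
    (thresholdStep v b B x coin s i).steps ≤ 23 := by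
  simp only [thresholdStep, Timed.steps_bind, tick_steps]
  by_cases h : B < b i
  · rw [if_pos h]
    simp
  · rw [if_neg h]
    simp only [marginal, Timed.steps_bind, query_steps, tick_steps, Timed.steps_pure]
    split_ifs <;> simp

theorem IsValuation.restrict {v : Finset (Fin n) → ℝ} (hv : IsValuation v)
    (X : Finset (Fin n)) :
    IsValuation fun S : Finset X => v (S.map (Function.Embedding.subtype _)) where
  empty := by simp [hv.empty]
  nonneg S := hv.nonneg _
  submodular S T h i hi := by
    simp only [Finset.map_insert]
    exact hv.submodular _ _ (Finset.map_subset_map.2 h) _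
      fun hh => hi ((Finset.mem_map' _).1 hh)

theorem genSmOnline_steps_le (alg : KnapsackAlg n Ω) {v : Finset (Fin n) → ℝ}
    (hv : IsValuation v) {b : Fin n → ℝ} (hb : ∀ i, 0 ≤ b i) {B : ℝ} (hB : 0 < B) {q : ℕ}
    (hq : alg.RunsIn q) (σ : Equiv.Perm (Fin n)) (ρ : Seed n Ω) :
    (genSmOnline alg v b B σ ρ).steps ≤ 28 * n + 7 + q := by
  cases h : ρ.dynkin
  · simp only [genSmOnline, h, Timed.steps_bind, Bool.false_eq_true, if_false, Timed.steps_pure,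
      tick_steps, query_steps]
    have h1 := hq (((arrivals σ).take ρ.heads).toFinset.filter fun i => b i ≤ B) _
      (fun i => b i) B ρ.sub (hv.restrict _) (fun i => hb i) hB
    have h2 := Timed.steps_foldlM_le _ 23
      (thresholdStep_steps_le v b B
        (estimate alg v b B (sampleSet b B ((arrivals σ).take ρ.heads)) ρ.sub) ρ.coin)
      (State.init n B) ((arrivals σ).drop ρ.heads)
    have h3 : 23 * ((arrivals σ).drop ρ.heads).length ≤ 23 * n := by
      simp
    have h4 := h2.trans h3
    unfold estimate sampleSet State.init at h4
    unfold Seed.heads at h1 h4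
    simp only [query_val] at h1 h4 ⊢
    omega
  · simp only [genSmOnline, h, Timed.steps_bind, if_true, tick_steps]
    have := dynkin_steps_le v b B σ
    omega

end Algorithm

/-! ### Submodular functions -/

section Submodular

variable {α : Type} [DecidableEq α] {v : Finset α → ℝ}

theorem IsSubmodular.union_sub_le (h : IsSubmodular v) {S T : Finset α} (hST : S ⊆ T)
    (C : Finset α) (hC : Disjoint C T) : v (T ∪ C) - v T ≤ v (S ∪ C) - v S := by
  induction C using Finset.induction_on with
  | empty => simp
  | insert a C ha ih =>
    rw [Finset.disjoint_insert_left] at hC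
    have h1 := ih hC.2
    have h2 := h (S ∪ C) (T ∪ C) (Finset.union_subset_union hST subset_rfl) a (by simp [hC.1, ha])
    rw [Finset.union_insert, Finset.union_insert]
    linarith

theorem IsSubmodular.union_add_inter_le (h : IsSubmodular v) (S T : Finset α) :
    v (S ∪ T) + v (S ∩ T) ≤ v S + v T := by
  have h1 := h.union_sub_le (Finset.inter_subset_left : S ∩ T ⊆ S) (T \ S)
    Finset.sdiff_disjoint
  have h2 : S ∪ T \ S = S ∪ T := Finset.union_sdiff_self_eq_union
  have h3 : S ∩ T ∪ T \ S = T := by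
    ext a
    simp only [Finset.mem_union, Finset.mem_inter, Finset.mem_sdiff]
    tauto
  rw [h2, h3] at h1
  linarith

/-- Inserting the elements of `Q \ S` one at a time, each gains at most its marginal value for `S`
alone. -/
theorem IsSubmodular.union_le_add_sum (h : IsSubmodular v) (S Q : Finset α) :
    v (S ∪ Q) ≤ v S + ∑ i ∈ Q \ S, (v (insert i S) - v S) := by
  suffices H : ∀ C : Finset α, Disjoint C S →
      v (S ∪ C) ≤ v S + ∑ i ∈ C, (v (insert i S) - v S) by
    simpa using H (Q \ S) Finset.sdiff_disjoint
  intro C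
  induction C using Finset.induction_on with
  | empty => simp
  | insert a C ha ih =>
    intro hC
    rw [Finset.disjoint_insert_left] at hC
    have h1 := h S (S ∪ C) Finset.subset_union_left a (by simp [hC.1, ha])
    rw [Finset.union_insert, Finset.sum_insert ha]
    linarith [ih hC.2]

/-- Every set carries weights that bound the values of its subsets from below. -/
theorem IsValuation.exists_weights (hv : IsValuation v) (O : Finset α) :
    ∃ w : α → ℝ, ∑ i ∈ O, w i = v O ∧ (∀ D ⊆ O, ∑ i ∈ D, w i ≤ v D) ∧
      ∀ i ∈ O, v O - v (O.erase i) ≤ w i ∧ w i ≤ v {i} := by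
  induction O using Finset.induction_on with
  | empty =>
    refine ⟨fun _ => 0, by simp [hv.empty], fun D _ => by simpa using hv.nonneg D, by simp⟩
  | insert a O ha ih =>
    obtain ⟨w, h1, h2, h3⟩ := ih
    have hw : ∀ D ⊆ O, ∑ i ∈ D, Function.update w a (v (insert a O) - v O) i = ∑ i ∈ D, w i := by
      intro D hD
      refine Finset.sum_congr rfl fun i hi => Function.update_of_ne ?_ _ _
      rintro rfl
      exact ha (hD hi)
    -- The weights are the marginal values in order of insertion. The marginal value of `a` for `O`
    -- is at most that for any `D.erase a ⊆ O`, which gives the bound on subsets.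
    refine ⟨Function.update w a (v (insert a O) - v O), ?_, ?_, ?_⟩
    · rw [Finset.sum_insert ha, hw O subset_rfl, h1, Function.update_self]
      ring
    · intro D hD
      by_cases haD : a ∈ D
      · have hD' : D.erase a ⊆ O := Finset.subset_insert_iff.1 hD
        rw [← Finset.insert_erase haD, Finset.sum_insert (by simp), hw _ hD',
          Function.update_self]
        have := hv.submodular (D.erase a) O hD' a ha
        linarith [h2 _ hD']
      · have hD' : D ⊆ O := (Finset.subset_insert_iff_of_notMem haD).1 hD
        rw [hw D hD']
        exact h2 D hD'
    · intro i hi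
      rcases Finset.mem_insert.1 hi with rfl | hiO
      · rw [Finset.erase_insert ha, Function.update_self]
        refine ⟨le_rfl, ?_⟩
        have := hv.submodular ∅ O (by simp) i ha
        rw [hv.empty] at this
        simpa using this
      · have hne : i ≠ a := by rintro rfl; exact ha hiO
        rw [Function.update_of_ne hne]
        refine ⟨?_, (h3 i hiO).2⟩
        have h4 := hv.submodular.union_sub_le (Finset.erase_subset i O) {a} (by simpa using ha)
        have h5 := (h3 i hiO).1
        rw [Finset.erase_insert_of_ne hne.symm]
        rw [Finset.union_comm, ← Finset.insert_eq, Finset.union_comm, ← Finset.insert_eq] at h4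
        linarith

end Submodular

section Algorithm

open Classical

variable {n : ℕ} {Ω : Type}

/-! ### The value of the threshold phase -/

theorem State.marginal_le_target (v : Finset (Fin n) → ℝ) (s : State n) (i : Fin n) (j : Fin 2) :
    v (insert i (s.S j)) - v (s.S j) ≤
      v (insert i (s.S (s.target v i))) - v (s.S (s.target v i)) := by
  unfold State.target
  split_ifs with h <;> fin_cases j <;> simp_all <;> linarith

theorem State.offer_eq (v : Finset (Fin n) → ℝ) (B x : ℝ) (s : State n) (i : Fin n) :
    s.offer v B x i = β * B / x *
      (v (insert i (s.S (s.target v i))) - v (s.S (s.target v i))) := by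
  unfold State.offer State.target
  split_ifs with h
  · rw [max_eq_left h]
  · rw [max_eq_right (le_of_not_ge h)]

/-- Invariants of the threshold phase, where `Q` is a set of agents to compare with. Either a
budget is nearly exhausted, or the marginal values of the agents in `Q` are bounded. -/
structure State.Greedy (v : Finset (Fin n) → ℝ) (c : Fin n → ℝ) (B x M : ℝ)
    (Q P : Finset (Fin n)) (s : State n) : Prop where
  S_subset : ∀ j, s.S j ⊆ P
  disjoint : Disjoint (s.S 0) (s.S 1)
  budget_eq : ∀ j, s.budget j = B - β * B / x * v (s.S j)
  bound : (∃ j, B ≤ β * B / x * (v (s.S j) + M)) ∨ ∀ j j', j ≠ j' →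
    ∑ i ∈ (Q ∩ P) \ s.S j, (v (insert i (s.S j)) - v (s.S j)) ≤
      v (s.S j') + ∑ i ∈ Q ∩ P, c i / (β * B / x)

/-- Only `i ∈ Q` matters. If the offer was open, `c i ≤ B` means that the cost exceeds the offer; so
both marginal values are at most `c i / (β * B / x)`, the amount added to the cost sum. If a
positive `x` leaves the offer closed, the remaining budget is less than `β * B / x` times a marginal
value, and the latter is at most `v {i} ≤ M`: this budget is nearly exhausted. -/
theorem State.Greedy.reject {v : Finset (Fin n) → ℝ} (hv : IsValuation v) {c : Fin n → ℝ}
    {B x M : ℝ} (hx : 0 < x) (hk : 0 < β * B / x) (hM : ∀ i, c i ≤ B → v {i} ≤ M)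
    {Q P : Finset (Fin n)} (hQ : ∀ i ∈ Q, c i ≤ B) {s : State n} (h : s.Greedy v c B x M Q P)
    {i : Fin n} (hi : i ∉ P) (hrej : ¬ s.Accepts v c B x i) :
    s.Greedy v c B x M Q (insert i P) := by
  have hiS : ∀ j, i ∉ s.S j := fun j hj => hi (h.S_subset j hj)
  refine ⟨fun j => (h.S_subset j).trans (Finset.subset_insert _ _), h.disjoint, h.budget_eq, ?_⟩
  rcases h.bound with hb | hb
  · exact Or.inl hb
  by_cases hiQ : i ∈ Q
  · have hiP : i ∉ Q ∩ P := fun hh => hi (Finset.mem_inter.1 hh).2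
    rw [Finset.inter_insert_of_mem hiQ]
    by_cases hopen : s.Open v B x i
    · right
      intro j j' hjj
      have h1 := hb j j' hjj
      have h2 : s.offer v B x i < c i := by
        by_contra hcon
        exact hrej ⟨hopen, le_min (not_lt.1 hcon) (hQ i hiQ)⟩
      rw [State.offer_eq] at h2
      have h3 := State.marginal_le_target v s i j
      have h4 : v (insert i (s.S j)) - v (s.S j) ≤ c i / (β * B / x) := by
        rw [le_div_iff₀ hk]
        nlinarith
      rw [Finset.insert_sdiff_of_notMem _ (hiS j), Finset.sum_insert (by simp [hiP]),
        Finset.sum_insert hiP]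
      linarith
    · left
      refine ⟨s.target v i, ?_⟩
      have h2 : s.budget (s.target v i) < s.offer v B x i := by
        by_contra hcon
        exact hopen ⟨hx, not_lt.1 hcon⟩
      rw [State.offer_eq, h.budget_eq] at h2
      have h3 := hv.submodular ∅ (s.S (s.target v i)) (by simp) i (hiS _)
      rw [hv.empty, sub_zero, insert_empty_eq] at h3
      have h4 := hM i (hQ i hiQ)
      nlinarith
  · right
    rw [Finset.inter_insert_of_notMem hiQ]
    exact hb

/-- For the set that `i` joins, the sum keeps its index set and its terms shrink by submodularity.
For the other set there may be a new term for `i`, but the target maximizes the marginal value, so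
the growth of the value of the target pays for it. An accepted offer is non-negative, so values
never drop and an exhausted budget stays exhausted. -/
theorem State.Greedy.accept {v : Finset (Fin n) → ℝ} (hv : IsValuation v) {c : Fin n → ℝ}
    (hc : ∀ i, 0 ≤ c i) {B x M : ℝ} (hk : 0 < β * B / x) (coin : Fin n → Bool)
    {Q P : Finset (Fin n)} {s : State n} (h : s.Greedy v c B x M Q P)
    {i : Fin n} (hi : i ∉ P) (hacc : s.Accepts v c B x i) :
    (s.accept v B x coin i).Greedy v c B x M Q (insert i P) := by
  have hiS : ∀ j, i ∉ s.S j := fun j hj => hi (h.S_subset j hj)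
  have hiP : i ∉ Q ∩ P := fun hh => hi (Finset.mem_inter.1 hh).2
  have hoff : 0 ≤ s.offer v B x i := (hc i).trans (hacc.2.trans (min_le_left _ _))
  have hS : ∀ j, (s.accept v B x coin i).S j =
      if j = s.target v i then insert i (s.S j) else s.S j := by
    intro j
    by_cases hj : j = s.target v i
    · subst hj; simp [State.accept]
    · simp [State.accept, hj]
  have hmarg : 0 ≤ v (insert i (s.S (s.target v i))) - v (s.S (s.target v i)) := by
    rw [State.offer_eq] at hoff
    exact nonneg_of_mul_nonneg_right hoff hk
  have hmono : ∀ j, v (s.S j) ≤ v ((s.accept v B x coin i).S j) := by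
    intro j
    rw [hS]
    split_ifs with hj
    · subst hj; linarith
    · exact le_rfl
  refine ⟨?_, ?_, ?_, ?_⟩
  · intro j
    rw [hS]
    split_ifs
    · exact Finset.insert_subset_insert i (h.S_subset j)
    · exact (h.S_subset j).trans (Finset.subset_insert _ _)
  · rw [hS, hS]
    have := h.disjoint
    split_ifs with h0 h1 h1
    · rw [← h0] at h1; simp at h1
    · simpa [Finset.disjoint_insert_left, hiS] using this
    · simpa [Finset.disjoint_insert_right, hiS] using this
    · exact this
  · intro j
    rw [hS]
    by_cases hj : j = s.target v i
    · subst hj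
      simp only [State.accept, Function.update_self, if_true]
      rw [h.budget_eq, State.offer_eq]
      ring
    · simp only [State.accept, Function.update_of_ne hj, if_neg hj, h.budget_eq]
  · rcases h.bound with ⟨j, hj⟩ | hb
    · exact Or.inl ⟨j, hj.trans (by have := hmono j; gcongr)⟩
    right
    intro j j' hjj
    have h1 := hb j j' hjj
    have hcost : ∑ a ∈ Q ∩ P, c a / (β * B / x) ≤
        ∑ a ∈ Q ∩ insert i P, c a / (β * B / x) :=
      Finset.sum_le_sum_of_subset_of_nonneg
        (Finset.inter_subset_inter subset_rfl (Finset.subset_insert _ _))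
        fun a _ _ => div_nonneg (hc a) hk.le
    by_cases hj : j = s.target v i
    · have h2 := hmono j'
      rw [hS j, if_pos hj]
      have hset : (Q ∩ insert i P) \ insert i (s.S j) = (Q ∩ P) \ s.S j := by
        ext a
        simp only [Finset.mem_sdiff, Finset.mem_inter, Finset.mem_insert]
        constructor
        · tauto
        · rintro ⟨⟨h3, h4⟩, h5⟩
          have : a ≠ i := by rintro rfl; exact hi h4
          tauto
      rw [hset]
      have h3 : ∑ a ∈ (Q ∩ P) \ s.S j, (v (insert a (insert i (s.S j))) - v (insert i (s.S j))) ≤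
          ∑ a ∈ (Q ∩ P) \ s.S j, (v (insert a (s.S j)) - v (s.S j)) := by
        refine Finset.sum_le_sum fun a ha => ?_
        refine hv.submodular _ _ (Finset.subset_insert _ _) a ?_
        simp only [Finset.mem_sdiff, Finset.mem_inter] at ha
        rw [Finset.mem_insert, not_or]
        refine ⟨?_, ha.2⟩
        rintro rfl
        exact hi ha.1.2
      linarith
    · have hj' : j' = s.target v i := by omega
      rw [hS j, if_neg hj, hS j', if_pos hj']
      rw [← hj'] at hmarg
      by_cases hiQ : i ∈ Q
      · have h3 := State.marginal_le_target v s i j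
        rw [← hj'] at h3
        rw [Finset.inter_insert_of_mem hiQ] at hcost ⊢
        rw [Finset.insert_sdiff_of_notMem _ (hiS j), Finset.sum_insert (by simp [hiP])]
        linarith
      · rw [Finset.inter_insert_of_notMem hiQ]
        linarith

/-- Either a budget of the threshold phase is nearly exhausted, or the sets `S₁` and `S₂` compete
with every affordable set of later arrivals. -/
theorem State.value_run {v : Finset (Fin n) → ℝ} (hv : IsValuation v) {c : Fin n → ℝ}
    (hc : ∀ i, 0 ≤ c i) {B x M : ℝ} (hB : 0 < B) (hx : 0 < x)
    (hM : ∀ i, c i ≤ B → v {i} ≤ M) (coin : Fin n → Bool)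
    {l : List (Fin n)} (hl : l.Nodup) {Q : Finset (Fin n)} (hQl : Q ⊆ l.toFinset)
    (hQ : ∑ i ∈ Q, c i ≤ B) :
    x / β - M ≤ v (((State.init n B).run v c B x coin l).S 0) +
        v (((State.init n B).run v c B x coin l).S 1) ∨
      v Q ≤ 2 * (v (((State.init n B).run v c B x coin l).S 0) +
        v (((State.init n B).run v c B x coin l).S 1)) + 2 * (x / β) := by
  have hβ : 0 < β := by unfold β; norm_num
  have hk : 0 < β * B / x := by positivity
  have hQB : ∀ i ∈ Q, c i ≤ B := fun i hi =>
    (Finset.single_le_sum (fun j _ => hc j) hi).trans hQ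
  have hinv := State.run_invariant (v := v) (b := c) (B := B) (x := x) (coin := coin)
    (fun P s => s.Greedy v c B x M Q P) hl (by
      constructor
      · simp [State.init]
      · simp [State.init]
      · simp [State.init, hv.empty]
      · right; intro j j' _; simp [State.init, hv.empty])
    (fun P s i _ hi h hrej => h.reject hv hx hk hM hQB hi hrej)
    (fun P s i _ hi h hacc => h.accept hv hc hk coin hi hacc)
  set s := (State.init n B).run v c B x coin l
  rcases hinv.bound with ⟨j, hj⟩ | hb
  · left
    have h0 := hv.nonneg (s.S 0)
    have h1 := hv.nonneg (s.S 1)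
    have h2 : x / β ≤ v (s.S j) + M := by
      rw [div_le_iff₀ hβ]
      rw [div_mul_eq_mul_div, le_div_iff₀ hx] at hj
      have : B * x ≤ B * ((v (s.S j) + M) * β) := by linarith
      exact le_of_mul_le_mul_left this hB
    have h3 : v (s.S j) ≤ v (s.S 0) + v (s.S 1) := by
      fin_cases j <;> simp <;> linarith
    linarith
  · right
    rw [Finset.inter_eq_left.2 hQl] at hb
    have hcost : ∑ i ∈ Q, c i / (β * B / x) ≤ x / β := by
      rw [← Finset.sum_div, div_le_iff₀ hk]
      have : x / β * (β * B / x) = B := by field_simp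
      linarith
    have h01 := hb 0 1 (by decide)
    have h10 := hb 1 0 (by decide)
    have u0 := hv.submodular.union_le_add_sum (s.S 0) Q
    have u1 := hv.submodular.union_le_add_sum (s.S 1) Q
    -- By disjointness of the two sets the intersection here is `Q`; the value of the union is
    -- non-negative and is dropped.
    have hun := hv.submodular.union_add_inter_le (s.S 0 ∪ Q) (s.S 1 ∪ Q)
    have hint : (s.S 0 ∪ Q) ∩ (s.S 1 ∪ Q) = Q := by
      rw [← Finset.inter_union_distrib_right, Finset.disjoint_iff_inter_eq_empty.1 hinv.disjoint,
        Finset.empty_union]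
    rw [hint] at hun
    have := hv.nonneg (s.S 0 ∪ Q ∪ (s.S 1 ∪ Q))
    linarith

end Algorithm

/-! ### Expectations -/

section Expectation

variable {α γ : Type} [Fintype α] [Fintype γ]

theorem sum_toReal_eq_one (p : PMF α) : ∑ a, (p a).toReal = 1 := by
  rw [← ENNReal.toReal_sum fun a _ => p.apply_ne_top a, ← tsum_fintype (L := .unconditional _),
    p.tsum_coe, ENNReal.toReal_one]

theorem expect_const (p : PMF α) (r : ℝ) : expect p (fun _ => r) = r := by
  rw [expect, ← Finset.sum_mul, sum_toReal_eq_one, one_mul]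

/-- A comparison on the support suffices; the offline solution is guaranteed to be affordable only
for seeds in the support. -/
theorem expect_mono (p : PMF α) {f g : α → ℝ} (h : ∀ a ∈ p.support, f a ≤ g a) :
    expect p f ≤ expect p g := by
  refine Finset.sum_le_sum fun a _ => ?_
  by_cases ha : a ∈ p.support
  · exact mul_le_mul_of_nonneg_left (h a ha) ENNReal.toReal_nonneg
  · simp [(PMF.apply_eq_zero_iff p a).2 ha]

theorem expect_nonneg (p : PMF α) {f : α → ℝ} (h : ∀ a, 0 ≤ f a) : 0 ≤ expect p f :=
  Finset.sum_nonneg fun a _ => mul_nonneg ENNReal.toReal_nonneg (h a)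

theorem expect_add (p : PMF α) (f g : α → ℝ) :
    expect p (fun a => f a + g a) = expect p f + expect p g := by
  simp [expect, mul_add, Finset.sum_add_distrib]

theorem expect_mul_left (p : PMF α) (r : ℝ) (f : α → ℝ) :
    expect p (fun a => r * f a) = r * expect p f := by
  rw [expect, expect, Finset.mul_sum]
  exact Finset.sum_congr rfl fun a _ => by ring

theorem expect_pure (a : α) (f : α → ℝ) : expect (PMF.pure a) f = f a := by
  classical
  rw [expect, Finset.sum_eq_single a]
  · simp
  · intro b _ hb
    simp [PMF.pure_apply, hb]
  · simp

theorem expect_bind (p : PMF α) (f : α → PMF γ) (g : γ → ℝ) :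
    expect (p.bind f) g = expect p fun a => expect (f a) g := by
  have h : ∀ c, ((p.bind f) c).toReal = ∑ a, (p a).toReal * (f a c).toReal := by
    intro c
    rw [PMF.bind_apply, tsum_fintype, ENNReal.toReal_sum]
    · simp
    · exact fun a _ => ENNReal.mul_ne_top (p.apply_ne_top a) ((f a).apply_ne_top c)
  simp only [expect, h, Finset.sum_mul, Finset.mul_sum]
  rw [Finset.sum_comm]
  exact Finset.sum_congr rfl fun a _ => Finset.sum_congr rfl fun c _ => by ring

theorem expect_uniform [Nonempty α] (f : α → ℝ) :
    expect (PMF.uniformOfFintype α) f = (∑ a, f a) / Fintype.card α := by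
  simp [expect, PMF.uniformOfFintype_apply, ← Finset.mul_sum, div_eq_inv_mul]

theorem le_expect_of_prob (p : PMF α) {A : Set α} {q r : ℝ} {f : α → ℝ}
    (hA : q ≤ (p.toOuterMeasure A).toReal) (hr : 0 ≤ r) (hf : ∀ a, 0 ≤ f a)
    (h : ∀ a ∈ p.support, a ∈ A → r ≤ f a) : q * r ≤ expect p f := by
  classical
  have h1 : (p.toOuterMeasure A).toReal * r = expect p fun a => if a ∈ A then r else 0 := by
    rw [PMF.toOuterMeasure_apply_fintype, ENNReal.toReal_sum, Finset.sum_mul, expect]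
    · refine Finset.sum_congr rfl fun a _ => ?_
      by_cases ha : a ∈ A <;> simp [ha]
    · intro a _
      by_cases ha : a ∈ A <;> simp [ha, p.apply_ne_top a]
  calc q * r ≤ (p.toOuterMeasure A).toReal * r := mul_le_mul_of_nonneg_right hA hr
    _ = _ := h1
    _ ≤ _ := expect_mono p fun a ha => by
      split_ifs with hh
      · exact h a ha hh
      · exact hf a

end Expectation

theorem expect_modeLaw (f : Bool → ℝ) :
    expect modeLaw f = 2 / 5 * f true + 3 / 5 * f false := by
  simp only [expect, Fintype.sum_bool, modeLaw, PMF.ofFintype_apply, if_true, Bool.false_eq_true,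
    if_false]
  rw [ENNReal.toReal_ofReal (by norm_num), ENNReal.toReal_ofReal (by norm_num)]

theorem expect_pickLaw (f : Bool × Fin 2 → ℝ) :
    expect pickLaw f = 2 / 5 * (f (true, 0) + f (true, 1)) +
      1 / 10 * (f (false, 0) + f (false, 1)) := by
  simp only [expect, Fintype.sum_prod_type, Fintype.sum_bool, Fin.sum_univ_two, pickLaw,
    PMF.ofFintype_apply, if_true, Bool.false_eq_true, if_false]
  rw [ENNReal.toReal_ofReal (by norm_num), ENNReal.toReal_ofReal (by norm_num)]
  ring

theorem expect_seedLaw {n : ℕ} {Ω : Type} [Fintype Ω] (law : PMF Ω) (f : Seed n Ω → ℝ) :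
    expect (seedLaw n law) f = expect modeLaw fun d => expect pickLaw fun p =>
      expect (PMF.uniformOfFintype (Fin n → Bool)) fun s =>
        expect (PMF.uniformOfFintype (Fin n → Bool)) fun u => expect law fun ω =>
          f ⟨d, p.1, p.2, s, u, ω⟩ := by
  have h : seedLaw n law = modeLaw.bind fun d => pickLaw.bind fun p =>
      (PMF.uniformOfFintype (Fin n → Bool)).bind fun s =>
        (PMF.uniformOfFintype (Fin n → Bool)).bind fun u => law.bind fun ω =>
          PMF.pure ⟨d, p.1, p.2, s, u, ω⟩ := rfl
  rw [h]
  simp only [expect_bind, expect_pure]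

/-! ### Random permutations and random subsets -/

section Random

variable {n : ℕ}

theorem exists_perm_pair {i j i' j' : Fin n} (h : i ≠ j) (h' : i' ≠ j') :
    ∃ τ : Equiv.Perm (Fin n), τ i = i' ∧ τ j = j' := by
  refine ⟨Equiv.swap (Equiv.swap i i' j) j' * Equiv.swap i i', ?_, ?_⟩
  · rw [Equiv.Perm.mul_apply, Equiv.swap_apply_left, Equiv.swap_apply_of_ne_of_ne _ h']
    intro hh
    have : Equiv.swap i i' i = Equiv.swap i i' j := by rw [Equiv.swap_apply_left]; exact hh
    exact h ((Equiv.swap i i').injective this)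
  · rw [Equiv.Perm.mul_apply, Equiv.swap_apply_left]

/-- Composition with a transposition shows that the sum does not depend on `i`; summed over all `i`,
each permutation contributes `∑ k, f k`. -/
theorem sum_perm_apply (i : Fin n) (f : Fin n → ℝ) :
    (n : ℝ) * ∑ σ : Equiv.Perm (Fin n), f (σ i) = (n.factorial : ℝ) * ∑ k, f k := by
  have h1 : ∀ i', ∑ σ : Equiv.Perm (Fin n), f (σ i') = ∑ σ : Equiv.Perm (Fin n), f (σ i) := by
    intro i'
    refine Fintype.sum_equiv (Equiv.mulRight (Equiv.swap i i')) _ _ fun σ => ?_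
    simp
  calc (n : ℝ) * ∑ σ : Equiv.Perm (Fin n), f (σ i)
      = ∑ i', ∑ σ : Equiv.Perm (Fin n), f (σ i') := by simp [h1]
    _ = ∑ σ : Equiv.Perm (Fin n), ∑ i', f (σ i') := Finset.sum_comm
    _ = ∑ _σ : Equiv.Perm (Fin n), ∑ k, f k :=
        Finset.sum_congr rfl fun σ _ => Equiv.sum_comp σ f
    _ = _ := by simp [Fintype.card_perm]

theorem sum_perm_apply_pair {i j : Fin n} (hij : i ≠ j) (f : Fin n → Fin n → ℝ) :
    ((n : ℝ) * (n - 1)) * ∑ σ : Equiv.Perm (Fin n), f (σ i) (σ j) =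
      (n.factorial : ℝ) * ∑ p ∈ (Finset.univ : Finset (Fin n)).offDiag, f p.1 p.2 := by
  have h1 : ∀ p ∈ (Finset.univ : Finset (Fin n)).offDiag,
      ∑ σ : Equiv.Perm (Fin n), f (σ p.1) (σ p.2) =
        ∑ σ : Equiv.Perm (Fin n), f (σ i) (σ j) := by
    intro p hp
    obtain ⟨τ, h2, h3⟩ := exists_perm_pair hij (Finset.mem_offDiag.1 hp).2.2
    refine Fintype.sum_equiv (Equiv.mulRight τ) _ _ fun σ => ?_
    simp [h2, h3]
  have hcard : (((Finset.univ : Finset (Fin n)).offDiag.card : ℕ) : ℝ) = (n : ℝ) * (n - 1) := by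
    rw [Finset.offDiag_card, Finset.card_univ, Fintype.card_fin,
      Nat.cast_sub (Nat.le_mul_self n)]
    push_cast
    ring
  calc ((n : ℝ) * (n - 1)) * ∑ σ : Equiv.Perm (Fin n), f (σ i) (σ j)
      = ∑ p ∈ (Finset.univ : Finset (Fin n)).offDiag,
          ∑ σ : Equiv.Perm (Fin n), f (σ p.1) (σ p.2) := by
        rw [Finset.sum_congr rfl h1, Finset.sum_const, nsmul_eq_mul, hcard]
    _ = ∑ σ : Equiv.Perm (Fin n), ∑ p ∈ (Finset.univ : Finset (Fin n)).offDiag,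
          f (σ p.1) (σ p.2) := Finset.sum_comm
    _ = ∑ _σ : Equiv.Perm (Fin n), ∑ p ∈ (Finset.univ : Finset (Fin n)).offDiag, f p.1 p.2 := by
        refine Finset.sum_congr rfl fun σ _ => ?_
        refine Finset.sum_equiv (Equiv.prodCongr σ σ) ?_ fun p _ => rfl
        intro p
        simp
    _ = _ := by simp [Fintype.card_perm]

theorem toFinset_take_arrivals (σ : Equiv.Perm (Fin n)) (r : ℕ) :
    ((arrivals σ).take r).toFinset =
      (Finset.univ.filter fun k : Fin n => (k : ℕ) < r).map σ.toEmbedding := by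
  ext i
  obtain ⟨k, rfl⟩ := σ.surjective i
  rw [List.mem_toFinset, mem_take_arrivals]
  simp

/-- A prefix of binomial length of a random permutation is a uniformly random set. -/
theorem sum_prefix (G : Finset (Fin n) → ℝ) :
    ∑ σ : Equiv.Perm (Fin n), ∑ s : Fin n → Bool,
      G ((arrivals σ).take (Finset.univ.filter fun i => s i = true).card).toFinset =
      (n.factorial : ℝ) * ∑ D : Finset (Fin n), G D := by
  rw [Finset.sum_comm]
  have h1 : ∀ s : Fin n → Bool, ∑ σ : Equiv.Perm (Fin n),
      G ((arrivals σ).take (Finset.univ.filter fun i => s i = true).card).toFinset =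
      ∑ σ : Equiv.Perm (Fin n),
        G ((Finset.univ.filter fun i => s i = true).map σ.toEmbedding) := by
    intro s
    set r := (Finset.univ.filter fun i => s i = true).card with hr
    have hrn : r ≤ n := by simpa using Finset.card_le_univ (Finset.univ.filter fun i => s i = true)
    have hcard : Fintype.card {i : Fin n // s i = true} =
        Fintype.card {k : Fin n // (k : ℕ) < r} := by
      rw [Fintype.card_subtype, Fintype.card_subtype, ← hr, Fin.card_filter_val_lt, min_eq_right hrn]
    -- Both sets of positions have `r` elements, so some `τ` carries the heads onto the first `r`
    -- positions; the sum over `σ` is invariant under `σ ↦ σ * τ`.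
    let e := Fintype.equivOfCardEq hcard
    let τ : Equiv.Perm (Fin n) := e.extendSubtype
    refine Fintype.sum_equiv (Equiv.mulRight τ) _ _ fun σ => ?_
    congr 1
    rw [toFinset_take_arrivals]
    have hτ : ∀ k, ((τ k : Fin n) : ℕ) < r ↔ s k = true := fun k =>
      ⟨fun hk => by_contra fun hs => e.extendSubtype_not_mem k hs hk,
        fun hs => e.extendSubtype_mem k hs⟩
    ext i
    obtain ⟨k, rfl⟩ := (σ * τ).surjective i
    simp [hτ]
    exact congrArg s ((σ * τ).symm_apply_apply k).symm
  simp only [h1]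
  rw [Finset.sum_comm]
  have h2 : ∀ σ : Equiv.Perm (Fin n), ∑ s : Fin n → Bool,
      G ((Finset.univ.filter fun i => s i = true).map σ.toEmbedding) = ∑ D, G D := by
    intro σ
    refine Finset.sum_nbij' (fun s => (Finset.univ.filter fun i => s i = true).map σ.toEmbedding)
      (fun D k => decide (σ k ∈ D)) (by simp) (by simp) ?_ ?_ (by simp)
    · intro s _
      funext k
      simp
    · intro D _
      ext i
      obtain ⟨k, rfl⟩ := σ.surjective i
      simp
  simp [h2, Fintype.card_perm]

/-- The variance of the weight of a random subset. -/
theorem sum_powerset_sq {α : Type} [DecidableEq α] (U : Finset α) (w : α → ℝ) :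
    ∑ D ∈ U.powerset, (∑ i ∈ D, w i - (∑ i ∈ U, w i) / 2) ^ 2 =
      2 ^ U.card / 4 * ∑ i ∈ U, w i ^ 2 := by
  induction U using Finset.induction_on with
  | empty => simp
  | insert a U ha ih =>
    -- With `u = w(D) - w(U) / 2`, the two squares are those of `u - w a / 2` and `u + w a / 2`;
    -- pairing `D` with `insert a D` cancels the mixed terms.
    have h1 : ∀ D ∈ U.powerset,
        (∑ i ∈ D, w i - (w a + ∑ i ∈ U, w i) / 2) ^ 2 +
          (∑ i ∈ insert a D, w i - (w a + ∑ i ∈ U, w i) / 2) ^ 2 =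
        2 * (∑ i ∈ D, w i - (∑ i ∈ U, w i) / 2) ^ 2 + w a ^ 2 / 2 := by
      intro D hD
      rw [Finset.sum_insert fun hh => ha (Finset.mem_powerset.1 hD hh)]
      ring
    rw [Finset.sum_powerset_insert ha, Finset.sum_insert ha, ← Finset.sum_add_distrib,
      Finset.sum_congr rfl h1, Finset.sum_add_distrib, ← Finset.mul_sum, ih, Finset.sum_insert ha,
      Finset.card_insert_of_notMem ha]
    simp only [Finset.sum_const, Finset.card_powerset, nsmul_eq_mul]
    push_cast
    ring

end Random

section Algorithm

open Classical

variable {n : ℕ} {Ω : Type}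

/-! ### The value of Dynkin's algorithm -/

theorem Better.asymm {v : Finset (Fin n) → ℝ} {i j : Fin n} (h : Better v i j) :
    ¬ Better v j i := by
  rintro (h2 | ⟨h2, h3⟩) <;> rcases h with h | ⟨h4, h5⟩
  · linarith
  · linarith
  · linarith
  · exact absurd h3 h5.asymm

theorem exists_best (v : Finset (Fin n) → ℝ) {F : Finset (Fin n)} (hF : F.Nonempty) :
    ∃ i ∈ F, ∀ j ∈ F, j ≠ i → Better v i j := by
  -- The dual order on labels reflects that smaller labels win ties.
  obtain ⟨i, hi, h⟩ := Finset.exists_max_image F (fun i => toLex (v {i}, OrderDual.toDual i)) hF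
  refine ⟨i, hi, fun j hj hne => ?_⟩
  rcases (Prod.Lex.le_iff.1 (h j hj)) with h1 | ⟨h1, h2⟩
  · exact Or.inl h1
  · exact Or.inr ⟨h1, lt_of_le_of_ne (OrderDual.toDual_le_toDual.1 h2) hne.symm⟩

theorem sampleBest_eq_some (v : Finset (Fin n) → ℝ) (b : Fin n → ℝ) (B : ℝ) {l : List (Fin n)}
    {j : Fin n} (hj : j ∈ l) (hjB : b j ≤ B)
    (h : ∀ a ∈ l, b a ≤ B → a ≠ j → Better v j a) : sampleBest v b B l = some j := by
  suffices H : ∀ (l : List (Fin n)) (s : Option (Fin n)),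
      (∀ a ∈ l, b a ≤ B → a ≠ j → Better v j a) → (∀ m ∈ s, m ≠ j → Better v j m) →
      (j ∈ l ∨ s = some j) → l.foldl (fun s i => (dynkinSample v b B s i).val) s = some j from
    H l none h (by simp) (Or.inl hj)
  intro l
  induction l with
  | nil => intro s _ _ h; simpa using h
  | cons a l ih =>
    intro s hl hs hor
    have hl' : ∀ a ∈ l, b a ≤ B → a ≠ j → Better v j a := fun a ha => hl a (by simp [ha])
    rw [List.foldl_cons, dynkinSample_val]
    split_ifs with hc
    · by_cases haj : a = j
      · subst haj
        exact ih _ hl' (by simp) (Or.inr rfl)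
      · have hb := hl a (by simp) hc.1 haj
        refine ih _ hl' (by simpa using fun _ => hb) (Or.inl ?_)
        rcases hor with hor | rfl
        · simpa [Ne.symm haj] using hor
        · exact absurd (hc.2 j rfl) hb.asymm
    · refine ih _ hl' hs ?_
      rcases hor with hor | hor
      · rcases List.mem_cons.1 hor with rfl | hor
        · right
          rcases s with _ | m
          · exact absurd ⟨hjB, by simp [BeatsBest]⟩ hc
          · by_contra hne
            have hm : m ≠ j := fun h => hne (by rw [h])
            exact hc ⟨hjB, by simpa [BeatsBest] using hs m rfl hm⟩
        · exact Or.inl hor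
      · exact Or.inr hor

/-- The best agent wins if she arrives after the sample and no later agent but her beats the
sample. -/
theorem dynkinWinner_eq_best {v : Finset (Fin n) → ℝ} {b : Fin n → ℝ} {B : ℝ}
    {σ : Equiv.Perm (Fin n)} {i : Fin n} (hi : b i ≤ B)
    (hbest : ∀ a, b a ≤ B → a ≠ i → Better v i a) (hpos : sampleSize n ≤ σ.symm i)
    (h : ∀ a, b a ≤ B → a ≠ i → sampleSize n ≤ σ.symm a → σ.symm a < σ.symm i →
      ¬ BeatsBest v a (sampleBest v b B ((arrivals σ).take (sampleSize n)))) :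
    dynkinWinner v b B σ = some i := by
  obtain ⟨k, rfl⟩ := σ.surjective i
  rw [Equiv.symm_apply_apply] at hpos h
  refine (dynkinWinner_eq_some v b B σ k).2 ⟨⟨hpos, ?_, ?_⟩, hi⟩
  · rcases hw : selectFirst v b B (sampleBest v b B ((arrivals σ).take (sampleSize n)))
      (((arrivals σ).take k).drop (sampleSize n)) with _ | w
    · rfl
    · obtain ⟨h1, h2, h3⟩ := foldl_select_mem _ _ _ _ _ _ hw
      obtain ⟨m, rfl⟩ := σ.surjective w
      have hmk : m < k := (mem_take_arrivals σ k m).1 (List.mem_of_mem_drop h1)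
      have hrm : sampleSize n ≤ m := by
        rw [← mem_drop_arrivals σ]
        exact ((List.take_sublist _ _).drop _).subset h1
      refine absurd h3 (h _ h2 (fun hh => hmk.ne (σ.injective hh)) ?_ ?_) <;>
        rwa [Equiv.symm_apply_apply]
  · intro j hj
    obtain ⟨h1, h2⟩ := sampleBest_mem _ _ _ _ _ hj
    refine hbest j h2 ?_
    rintro rfl
    rw [mem_take_arrivals] at h1
    omega

/-- With the second best agent `j` in the sample and the best one outside, `j` leads the sample and
only `i` beats her. -/
theorem dynkinWinner_eq_best_of_second {v : Finset (Fin n) → ℝ} {b : Fin n → ℝ} {B : ℝ}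
    {σ : Equiv.Perm (Fin n)} {i j : Fin n} (hi : b i ≤ B)
    (hbest : ∀ a, b a ≤ B → a ≠ i → Better v i a)
    (hsecond : ∀ a, b a ≤ B → a ≠ i → b j ≤ B ∧ (a ≠ j → Better v j a))
    (hposi : sampleSize n ≤ σ.symm i) (hposj : (σ.symm j : ℕ) < sampleSize n) :
    dynkinWinner v b B σ = some i := by
  refine dynkinWinner_eq_best hi hbest hposi fun a ha hai hra _ => ?_
  have hs := sampleBest_eq_some v b B (l := (arrivals σ).take (sampleSize n)) (j := j)
    (by
      have := (mem_take_arrivals σ (sampleSize n) (σ.symm j)).2 hposj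
      rwa [Equiv.apply_symm_apply] at this) (hsecond a ha hai).1
    (by
      intro a' ha' hB hne
      refine (hsecond a' hB ?_).2 hne
      rintro rfl
      have h2 := (mem_take_arrivals σ (sampleSize n) (σ.symm a')).1 (by simpa using ha')
      omega)
  rw [hs]
  intro hbeat
  have haj : a ≠ j := by
    rintro rfl
    omega
  exact ((hsecond a ha hai).2 haj).asymm (hbeat j rfl)

/-- If no affordable agent other than `i` exists, any `j ≠ i` serves, the requirement being vacuous.
-/
theorem exists_second {v : Finset (Fin n) → ℝ} {b : Fin n → ℝ} {B : ℝ} (hn : 2 ≤ n)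
    (i : Fin n) :
    ∃ j, j ≠ i ∧ ∀ a, b a ≤ B → a ≠ i → b j ≤ B ∧ (a ≠ j → Better v j a) := by
  rcases (Finset.univ.filter fun a => b a ≤ B ∧ a ≠ i).eq_empty_or_nonempty with h | h
  · have : Nontrivial (Fin n) := Fin.nontrivial_iff_two_le.2 hn
    obtain ⟨j, hj⟩ := exists_ne i
    refine ⟨j, hj, fun a ha hai => ?_⟩
    have : a ∈ Finset.univ.filter fun a => b a ≤ B ∧ a ≠ i := by simp [ha, hai]
    simp [h] at this
  · obtain ⟨j, hj, hbest⟩ := exists_best v h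
    simp only [Finset.mem_filter, Finset.mem_univ, true_and] at hj hbest
    exact ⟨j, hj.2, fun a ha hai => ⟨hj.1, hbest a ⟨ha, hai⟩⟩⟩

theorem exp_one_inv_bounds : 0.3678 < (Real.exp 1)⁻¹ ∧ (Real.exp 1)⁻¹ < 0.368 := by
  have h1 := Real.exp_one_gt_d9
  have h2 := Real.exp_one_lt_d9
  constructor
  · rw [lt_inv_comm₀ (by norm_num) (by positivity)]
    refine h2.trans (by norm_num)
  · rw [inv_lt_comm₀ (by positivity) (by norm_num)]
    refine lt_trans (by norm_num) h1

theorem sampleSize_bounds (n : ℕ) :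
    (sampleSize n : ℝ) ≤ 0.368 * n ∧ (0.3678 : ℝ) * n < sampleSize n + 1 := by
  obtain ⟨h1, h2⟩ := exp_one_inv_bounds
  have h0 : (0 : ℝ) ≤ n := n.cast_nonneg
  have h3 : (n : ℝ) / Real.exp 1 = (Real.exp 1)⁻¹ * n := by rw [div_eq_inv_mul]
  have h4 : (sampleSize n : ℝ) ≤ n / Real.exp 1 := Nat.floor_le (by positivity)
  have h5 : (n : ℝ) / Real.exp 1 < sampleSize n + 1 := Nat.lt_floor_add_one _
  rw [h3] at h4 h5
  constructor <;> nlinarith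

/-- With `r = sampleSize n`, the quotient `r (n - r) / (n (n - 1))` is the probability that one
given agent arrives after the sample and another one within it. The bounds `r ≥ n / 5` and `n - r ≥
0.632 n` suffice for `0.126`; the sharp constant `1 / e` is not needed. -/
theorem sampleSize_prob {n : ℕ} (hn : 3 ≤ n) :
    63 / 500 * ((n : ℝ) * (n - 1)) ≤ sampleSize n * (n - sampleSize n) := by
  obtain ⟨h1, h2⟩ := sampleSize_bounds n
  have hn' : (3 : ℝ) ≤ n := by exact_mod_cast hn
  have h3 : (n : ℝ) / 5 ≤ sampleSize n := by
    have h4 : 1 ≤ sampleSize n := by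
      by_contra hcon
      have h5 : sampleSize n = 0 := by omega
      rw [h5] at h2
      push_cast at h2
      linarith
    have h4' : (1 : ℝ) ≤ sampleSize n := by exact_mod_cast h4
    -- For `n ≤ 5`, `r ≥ 1` is enough; from `n = 6` on, `0.3678 * n - 1 ≥ n / 5`.
    rcases le_or_gt n 5 with h | h
    · have : (n : ℝ) ≤ 5 := by exact_mod_cast h
      linarith
    · have : (6 : ℝ) ≤ n := by exact_mod_cast h
      linarith
  have h6 : 0.632 * (n : ℝ) ≤ n - sampleSize n := by linarith
  have h7 : (n : ℝ) / 5 * (0.632 * n) ≤ sampleSize n * (n - sampleSize n) :=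
    mul_le_mul h3 h6 (by positivity) (by positivity)
  nlinarith

/-- For `n ≤ 2` the sample is empty and the best agent wins whenever she arrives first. For larger
`n` only the event of `dynkinWinner_eq_best_of_second` is counted. -/
theorem card_perm_le_of_dynkin (v : Finset (Fin n) → ℝ) {b : Fin n → ℝ} {B : ℝ} {i : Fin n}
    (hi : b i ≤ B) (hbest : ∀ a, b a ≤ B → a ≠ i → Better v i a) :
    63 / 500 * (n.factorial : ℝ) ≤
      ∑ σ : Equiv.Perm (Fin n), if dynkinWinner v b B σ = some i then (1 : ℝ) else 0 := by
  have hn0 : 0 < n := i.pos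
  have hinv : ∀ f : Equiv.Perm (Fin n) → ℝ, ∑ σ : Equiv.Perm (Fin n), f σ.symm = ∑ σ, f σ :=
    fun f => Equiv.sum_comp (Equiv.inv (Equiv.Perm (Fin n))) f
  rcases le_or_gt n 2 with hn | hn
  · have hr : sampleSize n = 0 := by
      have := (sampleSize_bounds n).1
      have hn' : (n : ℝ) ≤ 2 := by exact_mod_cast hn
      have h2 : (sampleSize n : ℝ) < 1 := by linarith
      have : sampleSize n < 1 := by exact_mod_cast h2
      omega
    have hz : ∀ σ : Equiv.Perm (Fin n), (if σ.symm i = ⟨0, hn0⟩ then (1 : ℝ) else 0) ≤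
        if dynkinWinner v b B σ = some i then (1 : ℝ) else 0 := by
      intro σ
      by_cases h : σ.symm i = ⟨0, hn0⟩
      · rw [if_pos h, if_pos]
        refine dynkinWinner_eq_best hi hbest (by omega) fun a _ _ _ hlt => ?_
        rw [h] at hlt
        exact absurd hlt (by simp [Fin.lt_def])
      · rw [if_neg h]
        split_ifs <;> norm_num
    refine le_trans ?_ (Finset.sum_le_sum fun σ _ => hz σ)
    rw [hinv fun σ => if σ i = ⟨0, hn0⟩ then (1 : ℝ) else 0]
    have h1 := sum_perm_apply i fun k => if k = ⟨0, hn0⟩ then (1 : ℝ) else 0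
    rw [Finset.sum_ite_eq' Finset.univ] at h1
    simp only [Finset.mem_univ, if_true, mul_one] at h1
    have hn' : (n : ℝ) ≤ 2 := by exact_mod_cast hn
    have h2 : (0 : ℝ) ≤ ∑ σ : Equiv.Perm (Fin n), if σ i = ⟨0, hn0⟩ then (1 : ℝ) else 0 :=
      Finset.sum_nonneg fun σ _ => by split_ifs <;> norm_num
    nlinarith
  · obtain ⟨j, hji, hsecond⟩ := exists_second (v := v) (b := b) (B := B) (by omega) i
    have hz : ∀ σ : Equiv.Perm (Fin n),
        (if sampleSize n ≤ σ.symm i ∧ (σ.symm j : ℕ) < sampleSize n then (1 : ℝ) else 0) ≤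
        if dynkinWinner v b B σ = some i then (1 : ℝ) else 0 := by
      intro σ
      by_cases h : sampleSize n ≤ σ.symm i ∧ (σ.symm j : ℕ) < sampleSize n
      · rw [if_pos h, if_pos (dynkinWinner_eq_best_of_second hi hbest hsecond h.1 h.2)]
      · rw [if_neg h]
        split_ifs <;> norm_num
    refine le_trans ?_ (Finset.sum_le_sum fun σ _ => hz σ)
    rw [hinv fun σ => if sampleSize n ≤ σ i ∧ (σ j : ℕ) < sampleSize n then (1 : ℝ) else 0]
    have h1 := sum_perm_apply_pair hji.symm fun k l : Fin n =>
      if sampleSize n ≤ k ∧ (l : ℕ) < sampleSize n then (1 : ℝ) else 0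
    have hrn : sampleSize n ≤ n := by
      have := (sampleSize_bounds n).1
      have h0 : (0 : ℝ) ≤ n := n.cast_nonneg
      have h2 : (sampleSize n : ℝ) ≤ n := by linarith
      exact_mod_cast h2
    have h2 : ∑ p ∈ (Finset.univ : Finset (Fin n)).offDiag,
        (if sampleSize n ≤ p.1 ∧ (p.2 : ℕ) < sampleSize n then (1 : ℝ) else 0) =
        sampleSize n * (n - sampleSize n) := by
      have h3 : ((Finset.univ : Finset (Fin n)).offDiag.filter fun p =>
          sampleSize n ≤ p.1 ∧ (p.2 : ℕ) < sampleSize n) =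
          (Finset.univ.filter fun k : Fin n => ¬ (k : ℕ) < sampleSize n) ×ˢ
            (Finset.univ.filter fun k : Fin n => (k : ℕ) < sampleSize n) := by
        ext p
        simp only [Finset.mem_filter, Finset.mem_offDiag, Finset.mem_univ, true_and,
          Finset.mem_product, not_lt]
        constructor
        · tauto
        · intro h
          refine ⟨?_, h⟩
          intro hh
          rw [hh] at h
          omega
      have h4 : (Finset.univ.filter fun k : Fin n => (k : ℕ) < sampleSize n).card =
          sampleSize n := by
        rw [Fin.card_filter_val_lt, min_eq_right hrn]
      have h5 : (Finset.univ.filter fun k : Fin n => ¬ (k : ℕ) < sampleSize n).card =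
          n - sampleSize n := by
        have := Finset.card_filter_add_card_filter_not (s := (Finset.univ : Finset (Fin n)))
          (fun k : Fin n => (k : ℕ) < sampleSize n)
        rw [h4, Finset.card_univ, Fintype.card_fin] at this
        omega
      rw [Finset.sum_boole, h3, Finset.card_product, h4, h5]
      push_cast [Nat.cast_sub hrn]
      ring
    rw [h2] at h1
    have h3 := sampleSize_prob (n := n) (by omega)
    have h4 : (0 : ℝ) ≤ n.factorial := by positivity
    have hn' : (3 : ℝ) ≤ n := by exact_mod_cast hn
    have h5 : 0 < (n : ℝ) * (n - 1) := by nlinarith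
    refine le_of_mul_le_mul_left ?_ h5
    rw [h1]
    nlinarith [mul_le_mul_of_nonneg_left h3 h4]

end Algorithm

/-! ### The offline optimum and its weights -/

section Optimum

variable {α : Type} [Fintype α]

theorem finite_opt_values (v : Finset α → ℝ) (c : α → ℝ) (B : ℝ) :
    {y | ∃ S : Finset α, ∑ i ∈ S, c i ≤ B ∧ v S = y}.Finite :=
  (Set.finite_range v).subset fun _ ⟨S, _, h⟩ => ⟨S, h⟩

theorem le_opt {v : Finset α → ℝ} {c : α → ℝ} {B : ℝ} {S : Finset α} (hS : ∑ i ∈ S, c i ≤ B) :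
    v S ≤ opt v c B :=
  le_csSup (finite_opt_values v c B).bddAbove ⟨S, hS, rfl⟩

theorem exists_opt (v : Finset α → ℝ) (c : α → ℝ) {B : ℝ} (hB : 0 ≤ B) :
    ∃ S : Finset α, ∑ i ∈ S, c i ≤ B ∧ v S = opt v c B :=
  (show Set.Nonempty {y | ∃ S : Finset α, ∑ i ∈ S, c i ≤ B ∧ v S = y} from
    ⟨v ∅, ∅, by simpa using hB, rfl⟩).csSup_mem (finite_opt_values v c B)

theorem opt_nonneg [DecidableEq α] {v : Finset α → ℝ} (hv : IsValuation v) (c : α → ℝ) {B : ℝ}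
    (hB : 0 ≤ B) : 0 ≤ opt v c B := by
  obtain ⟨S, _, h⟩ := exists_opt v c hB
  exact h ▸ hv.nonneg S

/-- An optimal solution carries non-negative weights that bound the values of subsets from below. -/
theorem IsValuation.exists_opt_weights [DecidableEq α] {v : Finset α → ℝ} (hv : IsValuation v)
    {c : α → ℝ} (hc : ∀ i, 0 ≤ c i) {B : ℝ} (hB : 0 ≤ B) :
    ∃ (O : Finset α) (w : α → ℝ), ∑ i ∈ O, c i ≤ B ∧ ∑ i, w i = opt v c B ∧
      (∀ D, ∑ i ∈ D, w i ≤ v (O ∩ D)) ∧ ∀ i, 0 ≤ w i ∧ (w i = 0 ∨ (c i ≤ B ∧ w i ≤ v {i})) := by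
  obtain ⟨O, hO, hopt⟩ := exists_opt v c hB
  obtain ⟨w, h1, h2, h3⟩ := hv.exists_weights O
  have hsum : ∀ D : Finset α, ∑ i ∈ D, (if i ∈ O then w i else 0) = ∑ i ∈ O ∩ D, w i := by
    intro D
    rw [← Finset.sum_filter, Finset.filter_mem_eq_inter, Finset.inter_comm]
  refine ⟨O, fun i => if i ∈ O then w i else 0, hO, ?_, ?_, ?_⟩
  · rw [hsum, Finset.inter_univ, h1, hopt]
  · intro D
    rw [hsum]
    exact h2 _ Finset.inter_subset_left
  · intro i
    by_cases hi : i ∈ O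
    · simp only [if_pos hi]
      -- Without monotonicity, non-negative weights come from optimality: dropping `i` stays within
      -- the budget, so the last marginal value, a lower bound of `w i`, is non-negative.
      have h4 : v (O.erase i) ≤ v O := by
        rw [hopt]
        exact le_opt ((Finset.sum_le_sum_of_subset_of_nonneg (Finset.erase_subset i O)
          fun j _ _ => hc j).trans hO)
      refine ⟨by linarith [(h3 i hi).1], Or.inr ⟨?_, (h3 i hi).2⟩⟩
      exact (Finset.single_le_sum (fun j _ => hc j) hi).trans hO
    · simp [hi]

end Optimum

/-! ### The approximation guarantee -/

section Algorithm

open Classical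

variable {n : ℕ} {Ω : Type}

/-- The total value of the sets `S₁` and `S₂`. -/
def greedyValue (alg : KnapsackAlg n Ω) (v : Finset (Fin n) → ℝ) (b : Fin n → ℝ) (B : ℝ)
    (σ : Equiv.Perm (Fin n)) (ρ : Seed n Ω) : ℝ :=
  v ((finalState alg v b B σ ρ).S 0) + v ((finalState alg v b B σ ρ).S 1)

theorem le_opt_sampleSet (v : Finset (Fin n) → ℝ) {c : Fin n → ℝ} (hc : ∀ i, 0 ≤ c i) {B : ℝ}
    {O : Finset (Fin n)} (hO : ∑ i ∈ O, c i ≤ B) (l : List (Fin n)) :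
    v (O ∩ l.toFinset) ≤ opt (fun S : Finset (sampleSet c B l) =>
      v (S.map (Function.Embedding.subtype _))) (fun i => c i) B := by
  have hsub : O ∩ l.toFinset ⊆ sampleSet c B l := by
    intro i hi
    rw [Finset.mem_inter] at hi
    exact Finset.mem_filter.2 ⟨hi.2, (Finset.single_le_sum (fun j _ => hc j) hi.1).trans hO⟩
  have hmap : ((O ∩ l.toFinset).subtype fun i => i ∈ sampleSet c B l).map
      (Function.Embedding.subtype _) = O ∩ l.toFinset :=
    Finset.subtype_map_of_mem fun i hi => hsub hi
  have h := le_opt (v := fun S : Finset (sampleSet c B l) =>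
      v (S.map (Function.Embedding.subtype _))) (c := fun i => c i) (B := B)
    (S := (O ∩ l.toFinset).subtype fun i => i ∈ sampleSet c B l) (by
      have h1 := Finset.sum_map ((O ∩ l.toFinset).subtype fun i => i ∈ sampleSet c B l)
        (Function.Embedding.subtype _) c
      rw [hmap] at h1
      have h2 : ∑ i ∈ O ∩ l.toFinset, c i ≤ B :=
        (Finset.sum_le_sum_of_subset_of_nonneg Finset.inter_subset_left fun j _ _ => hc j).trans hO
      rw [h1] at h2
      exact h2)
  simpa only [hmap] using h

/-- The threshold phase finds good solutions if the sample is balanced and the offline subroutine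
succeeds. -/
theorem greedyValue_ge (alg : KnapsackAlg n Ω) {v : Finset (Fin n) → ℝ} (hv : IsValuation v)
    {c : Fin n → ℝ} (hc : ∀ i, 0 ≤ c i) {B : ℝ} (hB : 0 < B) {O : Finset (Fin n)}
    {w : Fin n → ℝ} {W M : ℝ} (hW : 0 < W) (hO : ∑ i ∈ O, c i ≤ B) (hWopt : opt v c B = W)
    (hwsum : ∑ i, w i = W) (hw : ∀ D, ∑ i ∈ D, w i ≤ v (O ∩ D))
    (hM : ∀ i, c i ≤ B → v {i} ≤ M) (hM0 : 0 ≤ M) (σ : Equiv.Perm (Fin n)) (ρ : Seed n Ω)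
    (h1 : 35 / 100 * W ≤ ∑ i ∈ ((arrivals σ).take ρ.heads).toFinset, w i)
    (h2 : ∑ i ∈ ((arrivals σ).take ρ.heads).toFinset, w i ≤ 65 / 100 * W)
    (hfeas : ∑ i ∈ (alg (sampleSet c B ((arrivals σ).take ρ.heads))
      (fun S => v (S.map (Function.Embedding.subtype _))) (fun i => c i) B ρ.sub).val, c i ≤ B)
    (happrox : 9 / 25 * opt (fun S : Finset (sampleSet c B ((arrivals σ).take ρ.heads)) =>
      v (S.map (Function.Embedding.subtype _))) (fun i => c i) B ≤
      estimate alg v c B (sampleSet c B ((arrivals σ).take ρ.heads)) ρ.sub) :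
    1444 / 100000 * W - M ≤ greedyValue alg v c B σ ρ := by
  have hlow := le_opt_sampleSet v hc hO ((arrivals σ).take ρ.heads)
  have hlow2 := hw ((arrivals σ).take ρ.heads).toFinset
  have hup : estimate alg v c B (sampleSet c B ((arrivals σ).take ρ.heads)) ρ.sub ≤ W := by
    rw [← hWopt]
    refine le_opt ?_
    rw [Finset.sum_map]
    exact hfeas
  set x := estimate alg v c B (sampleSet c B ((arrivals σ).take ρ.heads)) ρ.sub with hxdef
  -- The sampled part of `O` is a feasible solution of the subroutine's instance; `0.36 * 0.35 =
  -- 0.126`.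
  have hxlow : 9 / 25 * (35 / 100 * W) ≤ x := by linarith
  have hx : 0 < x := by linarith
  set Q := O ∩ ((arrivals σ).drop ρ.heads).toFinset with hQdef
  have hsplit : ∑ i ∈ ((arrivals σ).take ρ.heads).toFinset, w i +
      ∑ i ∈ ((arrivals σ).drop ρ.heads).toFinset, w i = W := by
    rw [← hwsum, ← Finset.sum_union]
    · congr 1
      ext i
      simp only [Finset.mem_union, List.mem_toFinset, Finset.mem_univ, iff_true]
      rw [← List.mem_append, List.take_append_drop]
      exact mem_arrivals σ i
    · rw [List.disjoint_toFinset_iff_disjoint]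
      refine List.disjoint_of_nodup_append ?_
      rw [List.take_append_drop]
      exact nodup_arrivals σ
  have hQw := hw ((arrivals σ).drop ρ.heads).toFinset
  have hQcost : ∑ i ∈ Q, c i ≤ B :=
    (Finset.sum_le_sum_of_subset_of_nonneg Finset.inter_subset_left fun j _ _ => hc j).trans hO
  have key := State.value_run hv hc hB hx hM ρ.coin
    ((nodup_arrivals σ).sublist (List.drop_sublist ρ.heads _)) (Q := Q)
    Finset.inter_subset_right hQcost
  change x / β - M ≤ greedyValue alg v c B σ ρ ∨
    v Q ≤ 2 * greedyValue alg v c B σ ρ + 2 * (x / β) at key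
  have hβ : β = 8.725 := rfl
  rw [hβ] at key
  -- In the first case `0.126 / 8.725 > 0.01444`. In the second, `v Q ≥ 0.35 * W` and `x ≤ W` give
  -- more than `0.06 * W`.
  rcases key with key | key
  · norm_num at key
    linarith
  · norm_num at key
    linarith

/-- A pointwise form of Chebyshev's inequality. The factor `1 - (Z - W / 2) ^ 2 / (0.15 * W) ^ 2` is
at most `1` for a balanced sample, where `greedyValue_ge` applies, and negative otherwise, where
non-negativity suffices. The variance can then be inserted by linearity. -/
theorem expect_greedyValue_ge [Fintype Ω] {alg : KnapsackAlg n Ω} {law : PMF Ω}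
    (halg : alg.IsApprox law (1 / Real.exp 1 - 78 / 10000) (1 / 100))
    {v : Finset (Fin n) → ℝ} (hv : IsValuation v)
    {c : Fin n → ℝ} (hc : ∀ i, 0 ≤ c i) {B : ℝ} (hB : 0 < B) {O : Finset (Fin n)}
    {w : Fin n → ℝ} {W M : ℝ} (hW : 0 < W) (hO : ∑ i ∈ O, c i ≤ B) (hWopt : opt v c B = W)
    (hwsum : ∑ i, w i = W) (hw : ∀ D, ∑ i ∈ D, w i ≤ v (O ∩ D))
    (hM : ∀ i, c i ≤ B → v {i} ≤ M) (hM0 : 0 ≤ M) (hMW : M ≤ 1444 / 100000 * W)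
    (σ : Equiv.Perm (Fin n)) (d t : Bool) (j : Fin 2) (s u : Fin n → Bool) :
    99 / 100 * ((1444 / 100000 * W - M) * (1 - (∑ i ∈ ((arrivals σ).take
        (Finset.univ.filter fun i => s i = true).card).toFinset, w i - W / 2) ^ 2 /
          (9 / 400 * W ^ 2))) ≤
      expect law fun ω => greedyValue alg v c B σ ⟨d, t, j, s, u, ω⟩ := by
  set Z := ∑ i ∈ ((arrivals σ).take
        (Finset.univ.filter fun i => s i = true).card).toFinset, w i with hZ
  have hnn : ∀ ω, 0 ≤ greedyValue alg v c B σ ⟨d, t, j, s, u, ω⟩ := fun ω =>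
    add_nonneg (hv.nonneg _) (hv.nonneg _)
  have hK : 0 ≤ 1444 / 100000 * W - M := by linarith
  have hW2 : 0 < 9 / 400 * W ^ 2 := by positivity
  by_cases hbal : (Z - W / 2) ^ 2 ≤ 9 / 400 * W ^ 2
  · have habs : |Z - W / 2| ≤ 3 / 20 * W := by
      apply abs_le_of_sq_le_sq _ (by positivity)
      linarith [show (3 / 20 * W) ^ 2 = 9 / 400 * W ^ 2 by ring]
    rw [abs_le] at habs
    have happ := halg (sampleSet c B ((arrivals σ).take
      (Finset.univ.filter fun i => s i = true).card))
      (fun S => v (S.map (Function.Embedding.subtype _))) (fun i => c i) B (hv.restrict _)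
      (fun i => hc i) hB
    have hmain : 99 / 100 * (1444 / 100000 * W - M) ≤
        expect law fun ω => greedyValue alg v c B σ ⟨d, t, j, s, u, ω⟩ := by
      refine le_expect_of_prob law (le_trans (by norm_num) happ.2) hK hnn fun ω hω hA => ?_
      refine greedyValue_ge alg hv hc hB hW hO hWopt hwsum hw hM hM0 σ ⟨d, t, j, s, u, ω⟩ ?_ ?_
        (happ.1 ω hω) (le_trans ?_ hA)
      · change _ ≤ Z
        linarith
      · change Z ≤ _
        linarith
      · refine mul_le_mul_of_nonneg_right ?_ (opt_nonneg (hv.restrict _) _ hB.le)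
        have := exp_one_inv_bounds.1
        rw [one_div]
        linarith
    refine le_trans ?_ hmain
    have hq : 0 ≤ (Z - W / 2) ^ 2 / (9 / 400 * W ^ 2) := by positivity
    nlinarith [mul_nonneg hK hq]
  · refine le_trans ?_ (expect_nonneg law hnn)
    have hq : 1 ≤ (Z - W / 2) ^ 2 / (9 / 400 * W ^ 2) := by
      rw [le_div_iff₀ hW2]
      linarith
    nlinarith [mul_nonneg hK (sub_nonneg.2 hq)]

/-- The variance is a quarter of `∑ i, w i ^ 2`, and `w i ^ 2 ≤ M * w i`. -/
theorem expect_deviation {w : Fin n → ℝ} {W M : ℝ} (hwsum : ∑ i, w i = W)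
    (hw0 : ∀ i, 0 ≤ w i) (hwM : ∀ i, w i ≤ M) :
    (expect (PMF.uniformOfFintype (Equiv.Perm (Fin n))) fun σ =>
      expect (PMF.uniformOfFintype (Fin n → Bool)) fun s =>
        (∑ i ∈ ((arrivals σ).take
          (Finset.univ.filter fun i => s i = true).card).toFinset, w i - W / 2) ^ 2) ≤
      M * W / 4 := by
  have h1 := sum_prefix fun D : Finset (Fin n) => (∑ i ∈ D, w i - W / 2) ^ 2
  have h2 := sum_powerset_sq (Finset.univ : Finset (Fin n)) w
  rw [hwsum, Finset.powerset_univ, Finset.card_univ, Fintype.card_fin] at h2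
  rw [h2] at h1
  have h3 : ∑ i, w i ^ 2 ≤ M * W := by
    rw [← hwsum, Finset.mul_sum]
    refine Finset.sum_le_sum fun i _ => ?_
    nlinarith [hw0 i, hwM i]
  simp only [expect_uniform]
  rw [← Finset.sum_div, h1, Fintype.card_perm, Fintype.card_fin, Fintype.card_fun,
    Fintype.card_bool, Fintype.card_fin]
  have hf : (0 : ℝ) < n.factorial := by positivity
  have hp : (0 : ℝ) < 2 ^ n := by positivity
  push_cast
  have : (n.factorial : ℝ) * (2 ^ n / 4 * ∑ i, w i ^ 2) / 2 ^ n / n.factorial =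
      (∑ i, w i ^ 2) / 4 := by
    field_simp
  rw [this]
  linarith

theorem expect_dynkin_ge {v : Finset (Fin n) → ℝ} (hv : IsValuation v) {b : Fin n → ℝ} {B : ℝ}
    {i : Fin n} (hi : b i ≤ B) (hbest : ∀ a, b a ≤ B → a ≠ i → Better v i a) :
    63 / 500 * v {i} ≤ expect (PMF.uniformOfFintype (Equiv.Perm (Fin n))) fun σ =>
      v (dynkinWinner v b B σ).toFinset := by
  have h1 := card_perm_le_of_dynkin v hi hbest
  rw [expect_uniform, Fintype.card_perm, Fintype.card_fin]
  have hf : (0 : ℝ) < n.factorial := by positivity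
  rw [le_div_iff₀ hf]
  calc 63 / 500 * v {i} * n.factorial = (63 / 500 * n.factorial) * v {i} := by ring
    _ ≤ (∑ σ : Equiv.Perm (Fin n), if dynkinWinner v b B σ = some i then (1 : ℝ) else 0) *
        v {i} := mul_le_mul_of_nonneg_right h1 (hv.nonneg _)
    _ = ∑ σ : Equiv.Perm (Fin n), (if dynkinWinner v b B σ = some i then (1 : ℝ) else 0) *
        v {i} := Finset.sum_mul _ _ _
    _ ≤ _ := Finset.sum_le_sum fun σ _ => by
      split_ifs with h
      · simp [h]
      · simpa using hv.nonneg _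

/-- The expected value of the mechanism is bounded by those of its two branches. -/
theorem expect_selected_ge [Fintype Ω] (alg : KnapsackAlg n Ω) (law : PMF Ω)
    {v : Finset (Fin n) → ℝ} (hv : IsValuation v) (c : Fin n → ℝ) (B : ℝ)
    (σ : Equiv.Perm (Fin n)) :
    2 / 5 * v (dynkinWinner v c B σ).toFinset +
      3 / 5 * (1 / 10 * expect (PMF.uniformOfFintype (Fin n → Bool)) fun s =>
        expect (PMF.uniformOfFintype (Fin n → Bool)) fun u => expect law fun ω =>
          greedyValue alg v c B σ ⟨false, false, 0, s, u, ω⟩) ≤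
      expect (seedLaw n law) fun ρ => v (selected alg v B σ ρ c) := by
  rw [expect_seedLaw, expect_modeLaw]
  have h1 : (expect pickLaw fun p =>
      expect (PMF.uniformOfFintype (Fin n → Bool)) fun s =>
        expect (PMF.uniformOfFintype (Fin n → Bool)) fun u => expect law fun ω =>
          v (selected alg v B σ ⟨true, p.1, p.2, s, u, ω⟩ c)) =
      v (dynkinWinner v c B σ).toFinset := by
    have h : ∀ (t : Bool) (j : Fin 2) (s u : Fin n → Bool) (ω : Ω),
        selected alg v B σ ⟨true, t, j, s, u, ω⟩ c = (dynkinWinner v c B σ).toFinset :=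
      fun t j s u ω => selected_dynkin alg v B σ _ c rfl
    simp only [h, expect_const]
  rw [h1, expect_pickLaw]
  have hT : ∀ p : Bool × Fin 2, 0 ≤ expect (PMF.uniformOfFintype (Fin n → Bool)) fun s =>
        expect (PMF.uniformOfFintype (Fin n → Bool)) fun u => expect law fun ω =>
          v (selected alg v B σ ⟨false, p.1, p.2, s, u, ω⟩ c) := fun p =>
    expect_nonneg _ fun s => expect_nonneg _ fun u => expect_nonneg _ fun ω => hv.nonneg _
  have hS : ((expect (PMF.uniformOfFintype (Fin n → Bool)) fun s =>
        expect (PMF.uniformOfFintype (Fin n → Bool)) fun u => expect law fun ω =>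
          greedyValue alg v c B σ ⟨false, false, 0, s, u, ω⟩) : ℝ) =
      (expect (PMF.uniformOfFintype (Fin n → Bool)) fun s =>
        expect (PMF.uniformOfFintype (Fin n → Bool)) fun u => expect law fun ω =>
          v (selected alg v B σ ⟨false, false, 0, s, u, ω⟩ c)) +
      (expect (PMF.uniformOfFintype (Fin n → Bool)) fun s =>
        expect (PMF.uniformOfFintype (Fin n → Bool)) fun u => expect law fun ω =>
          v (selected alg v B σ ⟨false, false, 1, s, u, ω⟩ c)) := by
    -- The bit `side` does not influence the run, so both sets are read off the same final state.
    have h : ∀ (j : Fin 2) (s u : Fin n → Bool) (ω : Ω),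
        selected alg v B σ ⟨false, false, j, s, u, ω⟩ c =
          (finalState alg v c B σ ⟨false, false, 0, s, u, ω⟩).S j :=
      fun j s u ω => selected_threshold alg v B σ _ c rfl
    simp only [← expect_add, h]
    rfl
  have h3 := hT (true, 0)
  have h4 := hT (true, 1)
  rw [hS]
  linarith

theorem approximation [Fintype Ω] {alg : KnapsackAlg n Ω} {law : PMF Ω}
    (halg : alg.IsApprox law (1 / Real.exp 1 - 78 / 10000) (1 / 100))
    {v : Finset (Fin n) → ℝ} (hv : IsValuation v)
    {c : Fin n → ℝ} (hc : ∀ i, 0 ≤ c i) {B : ℝ} (hB : 0 < B) :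
    opt v c B ≤ 1710 * expect (PMF.uniformOfFintype (Equiv.Perm (Fin n))) fun σ =>
      expect (seedLaw n law) fun ρ => v (selected alg v B σ ρ c) := by
  obtain ⟨O, w, hO, hwsum, hw, hwi⟩ := hv.exists_opt_weights hc hB.le
  have hnn : 0 ≤ expect (PMF.uniformOfFintype (Equiv.Perm (Fin n))) fun σ =>
      expect (seedLaw n law) fun ρ => v (selected alg v B σ ρ c) :=
    expect_nonneg _ fun σ => expect_nonneg _ fun ρ => hv.nonneg _
  generalize hWopt : opt v c B = W at hwsum ⊢
  rcases le_or_gt W 0 with hW | hW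
  · linarith
  have haff : (Finset.univ.filter fun i => c i ≤ B).Nonempty := by
    by_contra hne
    rw [Finset.not_nonempty_iff_eq_empty] at hne
    have : ∑ i, w i = 0 := Finset.sum_eq_zero fun i _ => by
      rcases (hwi i).2 with h | h
      · exact h
      · have : i ∈ Finset.univ.filter fun i => c i ≤ B := by simp [h.1]
        simp [hne] at this
    linarith
  obtain ⟨i, hi, hbest⟩ := exists_best v haff
  simp only [Finset.mem_filter, Finset.mem_univ, true_and] at hi hbest
  have hM : ∀ a, c a ≤ B → v {a} ≤ v {i} := by
    intro a ha
    by_cases hai : a = i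
    · rw [hai]
    · rcases hbest a ha hai with h | h
      · exact h.le
      · exact h.1.le
  have hM0 : 0 ≤ v {i} := hv.nonneg _
  have hD := expect_dynkin_ge hv hi hbest
  have hwM : ∀ a, w a ≤ v {i} := by
    intro a
    rcases (hwi a).2 with h | h
    · rw [h]; exact hM0
    · exact h.2.trans (hM a h.1)
  set M := v {i} with hMdef
  have hE := expect_mono (PMF.uniformOfFintype (Equiv.Perm (Fin n))) fun σ _ =>
    expect_selected_ge alg law hv c B σ
  rw [expect_add, expect_mul_left, expect_mul_left, expect_mul_left] at hE
  set E := expect (PMF.uniformOfFintype (Equiv.Perm (Fin n))) fun σ =>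
      expect (seedLaw n law) fun ρ => v (selected alg v B σ ρ c)
  have hG0 : 0 ≤ expect (PMF.uniformOfFintype (Equiv.Perm (Fin n))) fun σ =>
      expect (PMF.uniformOfFintype (Fin n → Bool)) fun s =>
        expect (PMF.uniformOfFintype (Fin n → Bool)) fun u => expect law fun ω =>
          greedyValue alg v c B σ ⟨false, false, 0, s, u, ω⟩ :=
    expect_nonneg _ fun σ => expect_nonneg _ fun s => expect_nonneg _ fun u =>
      expect_nonneg _ fun ω => add_nonneg (hv.nonneg _) (hv.nonneg _)
  -- If `M` is large, Dynkin's branch alone suffices: `2/5 * 0.126 * 0.01444 > 1/1710`.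
  rcases le_or_gt M (1444 / 100000 * W) with hMW | hMW
  · have hK : 0 ≤ 1444 / 100000 * W - M := by linarith
    have hG : 99 / 100 * ((1444 / 100000 * W - M) * (1 - M / (9 / 100 * W))) ≤
        expect (PMF.uniformOfFintype (Equiv.Perm (Fin n))) fun σ =>
          expect (PMF.uniformOfFintype (Fin n → Bool)) fun s =>
            expect (PMF.uniformOfFintype (Fin n → Bool)) fun u => expect law fun ω =>
              greedyValue alg v c B σ ⟨false, false, 0, s, u, ω⟩ := by
      have h1 := expect_mono (PMF.uniformOfFintype (Equiv.Perm (Fin n))) fun σ _ =>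
        expect_mono (PMF.uniformOfFintype (Fin n → Bool)) fun s _ =>
          expect_mono (PMF.uniformOfFintype (Fin n → Bool)) fun u _ =>
            expect_greedyValue_ge halg hv hc hB hW hO hWopt hwsum hw hM hM0 hMW σ
              false false 0 s u
      refine le_trans ?_ h1
      have hdev := expect_deviation hwsum (fun i => (hwi i).1) hwM
      set C := 99 / 100 * (1444 / 100000 * W - M) / (9 / 400 * W ^ 2) with hC
      have hC0 : 0 ≤ C := by positivity
      have hlin : ∀ y : ℝ, 99 / 100 * ((1444 / 100000 * W - M) * (1 - y / (9 / 400 * W ^ 2))) =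
          99 / 100 * (1444 / 100000 * W - M) + -C * y := fun y => by rw [hC]; ring
      simp only [hlin, expect_const, expect_mul_left, expect_add]
      have hCM : C * (M * W / 4) =
          99 / 100 * (1444 / 100000 * W - M) * (M / (9 / 100 * W)) := by
        rw [hC]
        field_simp
        ring
      have := mul_le_mul_of_nonneg_left hdev hC0
      linarith
    obtain ⟨y, hy⟩ : ∃ y, M = y * W := ⟨M / W, by field_simp⟩
    have hx : M / (9 / 100 * W) = 100 / 9 * y := by
      rw [hy]
      field_simp
    rw [hx, hy] at hG
    rw [hy] at hD
    -- A convex quadratic in `y = M / W` with its minimum near `0.014`, whence the hint.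
    have hquad : 1 / 1710 ≤ 2 / 5 * (63 / 500 * y) +
        3 / 5 * (1 / 10 * (99 / 100 * ((1444 / 100000 - y) * (1 - 100 / 9 * y)))) := by
      nlinarith [sq_nonneg (y - 0.014)]
    have := mul_le_mul_of_nonneg_right hquad hW.le
    linarith
  · linarith

end Algorithm

end BudgetFeasible

end

theorem mainTheorem2 :
    ∃ (δ η : ℝ) (P : Polynomial ℕ), 0 < δ ∧ 0 < η ∧
      ∀ (n : ℕ) (Ω : Type) [Fintype Ω] (law : PMF Ω) (alg : BudgetFeasible.KnapsackAlg n Ω)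
        (B : ℝ), 0 < B →
      -- for all random bits, the mechanism is online
      (∀ ρ : BudgetFeasible.Seed n Ω,
        BudgetFeasible.IsOnline (BudgetFeasible.genSmMechanism alg B ρ)) ∧
      ∀ v : Finset (Fin n) → ℝ, BudgetFeasible.IsValuation v →
        -- for all random bits and all arrival orders, the mechanism is truthful, individually
        -- rational and budget-feasible, and it computes the threshold payments
        (∀ (ρ : BudgetFeasible.Seed n Ω) (σ : Equiv.Perm (Fin n)),
          (BudgetFeasible.genSmMechanism alg B ρ v σ).Truthful ∧
          (BudgetFeasible.genSmMechanism alg B ρ v σ).IndividuallyRational ∧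
          (BudgetFeasible.genSmMechanism alg B ρ v σ).IsBudgetFeasible B ∧
          ∀ b : Fin n → ℝ, (∀ i, 0 ≤ b i) →
            (BudgetFeasible.genSmOnline alg v b B σ ρ).val.2 =
              (BudgetFeasible.genSmMechanism alg B ρ v σ).payment b) ∧
        -- the running time is polynomial, apart from that of the single call of the subroutine
        (∀ q : ℕ, alg.RunsIn q →
          ∀ (ρ : BudgetFeasible.Seed n Ω) (σ : Equiv.Perm (Fin n)) (b : Fin n → ℝ),
            (∀ i, 0 ≤ b i) →
            (BudgetFeasible.genSmOnline alg v b B σ ρ).steps ≤ P.eval n + q) ∧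
        -- the approximation guarantee for uniformly random arrival order
        (alg.IsApprox law (1 / Real.exp 1 - η) δ →
          ∀ c : Fin n → ℝ, (∀ i, 0 ≤ c i) →
            BudgetFeasible.opt v c B ≤ 1710 *
              BudgetFeasible.expect (PMF.uniformOfFintype (Equiv.Perm (Fin n))) fun σ =>
                BudgetFeasible.expect (BudgetFeasible.seedLaw n law) fun ρ =>
                  v ((BudgetFeasible.genSmMechanism alg B ρ v σ).outcome c)) := by
  -- The value `0.0078` lowers `1 / e > 0.3678` to the ratio `0.36` used for the estimate, and `1 /
  -- 100` leaves the success probability `99 / 100`.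
  refine ⟨1 / 100, 78 / 10000, 28 * Polynomial.X + 7, by norm_num, by norm_num, ?_⟩
  intro n Ω _ law alg B hB
  refine ⟨fun ρ => BudgetFeasible.isOnline_genSmMechanism alg B ρ, fun v hv => ⟨?_, ?_, ?_⟩⟩
  · intro ρ σ
    rw [BudgetFeasible.genSmMechanism_eq]
    have hposted := BudgetFeasible.exists_isPosted alg v B σ ρ
    exact ⟨BudgetFeasible.truthful_of_posted hposted,
      BudgetFeasible.individuallyRational_of_posted hposted,
      BudgetFeasible.isBudgetFeasible_threshold alg v hB.le σ ρ,
      fun b hb => BudgetFeasible.genSmOnline_payment alg v hb hB.le σ ρ⟩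
  · intro q hq ρ σ b hb
    simpa using BudgetFeasible.genSmOnline_steps_le alg hv hb hB hq σ ρ
  · intro halg c hc
    exact BudgetFeasible.approximation halg hv hc hB
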